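/- Finite subsets of $\mathbb N$ are identified with their characteristic functions in $\{0,1\}^{\mathbb N}$. A family $\mathcal F$ of finite subsets of $\mathbb N$ is \emph{regular} if it is compact in $\{0,1\}^{\mathbb N}$, hereditary ($s\subseteq t\in\mathcal F$ implies $s\in\mathcal F$) and spreading (if $\{s_1<\dots<s_d\}\in\mathcal F$ and $t=\{t_1<\dots<t_d\}$ with $s_i\le t_i$ for all $i\le d$, then $t\in\mathcal F$). Put $\partial^{(0)}\mathcal F=\mathcal F$ and, for $\xi>0$, $\partial^{(\xi)}\mathcal F=\bigcap_{\eta<\xi}\partial(\partial^{(\eta)}\mathcal F)$, where $\partial\mathcal G$ is the set of proper accumulation points of $\mathcal G$; the index $\iota(\mathcal F)$ of a compact family is the least ordinal $\xi$ with $\partial^{(\xi)}\mathcal F\subseteq\{\emptyset\}$. A sequence $E_1,\dots,E_d$ of nonempty finite subsets of $\mathbb N$ is $\mathcal F$-admissible if there is $\{m_1<\dots<m_d\}\in\mathcal F$ with $m_1\le \min E_1\le\max E_1<m_2\le\min E_2\le\max E_2<\dots<m_d\le\min E_d$. For $0<\theta<1$, $T(\mathcal F,\theta)$ is the completion of the space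 $c_{00}$ of finitely supported real sequences under the norm given by $$\|x\|=\max\Big\{\|x\|_\infty,\ \sup\Big\{\theta\sum_{i=1}^d\|E_ix\| : (E_i)_{i=1}^d\ \text{is } \mathcal F\text{-admissible}\Big\}\Big\},$$ where $E_ix$ is the restriction of $x$ to $E_i$; equivalently $\|x\|=\sup\{f(x):f\in K\}$, where $K\subseteq c_{00}$ is the smallest set that contains $\pm e_n^*$ for all $n$ and contains $\theta(f_1+\dots+f_d)$ whenever $f_1,\dots,f_d\in K$ have $\mathcal F$-admissible supports. Let $(e_n)$ be the unit vector basis. \textbf{Theorem.} Let $\mathcal B_0$ and $\mathcal B_1$ be regular families with $\iota(\mathcal B_0)=\omega^{\alpha+\beta}$ and $\iota(\mathcal B_1)=\omega^{\alpha}$, where $\alpha\ge\omega$ and $0<\beta<\omega^{\lambda}\le\alpha$ for some ordinal $\lambda$ (that is, $\beta>0$ is smaller than the leading power of $\omega$ in the Cantor normal form of $\alpha$; equivalently $\beta>0$ and $\beta+\alpha=\alpha$). Let $0<\theta<1$. Then every infinite set $M\subseteq\mathbb N$ contains an infinite set $N$ such that the sequences $(e_n)_{n\in N}$ in $T(\mathcal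 B_0,\theta)$ and $(e_n)_{n\in N}$ in $T(\mathcal B_1,\theta)$ are equivalent: there is $C\ge1$ such that for all finitely supported real families $(a_n)_{n\in N}$, $$\frac1C\Big\|\sum_{n\in N}a_ne_n\Big\|_{T(\mathcal B_1,\theta)}\le\Big\|\sum_{n\in N}a_ne_n\Big\|_{T(\mathcal B_0,\theta)}\le C\Big\|\sum_{n\in N}a_ne_n\Big\|_{T(\mathcal B_1,\theta)}.$$ -/

import Mathlib

open scoped Ordinal

namespace Tsirelson

noncomputable section

/-! ### Families of finite sets of integers -/

/-- The characteristic function of a finite set of integers, a point of the Cantor space. -/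
def charFun (s : Finset ℕ) : ℕ → Bool := fun n => decide (n ∈ s)

/-- A family is compact if it is a compact (equivalently closed) subset of the Cantor space
`{0,1}^ℕ`, finite sets being identified with their characteristic functions. -/
def IsCompactFamily (F : Set (Finset ℕ)) : Prop := IsCompact (charFun '' F)

/-- Closed under taking subsets. -/
def IsHereditary (F : Set (Finset ℕ)) : Prop := ∀ t ∈ F, ∀ s ⊆ t, s ∈ F

/-- `s ⪯ t`: if `s = {s₁ < ⋯ < s_d}` then `t = {t₁ < ⋯ < t_d}` with `s_i ≤ t_i` for all `i`. -/
def SpreadLE (s t : Finset ℕ) : Prop :=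
  ∃ h : t.card = s.card, ∀ i : Fin s.card, s.orderEmbOfFin rfl i ≤ t.orderEmbOfFin h i

/-- A family is spreading if it is closed under moving the elements of its members upwards. -/
def IsSpreading (F : Set (Finset ℕ)) : Prop := ∀ s ∈ F, ∀ t, SpreadLE s t → t ∈ F

/-- A regular family is compact, hereditary and spreading. -/
structure IsRegular (F : Set (Finset ℕ)) : Prop where
  compact : IsCompactFamily F
  hereditary : IsHereditary F
  spreading : IsSpreading F

/-! ### The Cantor-Bendixson index -/

/-- The finite sets that are proper accumulation points of the family. -/
def derivFamily (F : Set (Finset ℕ)) : Set (Finset ℕ) :=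
  {s | AccPt (charFun s) (Filter.principal (charFun '' F))}

/-- The iterated derivatives: `∂⁽⁰⁾ F = F` and
`∂⁽ᵃ⁾ F = ⋂_{b < a} ∂ (∂⁽ᵇ⁾ F)` for `a > 0`
(the members of a derivative of a compact family belong to the family). -/
def iterDeriv (F : Set (Finset ℕ)) (a : Ordinal.{0}) : Set (Finset ℕ) :=
  {s | s ∈ F ∧ ∀ b, b < a → s ∈ derivFamily (iterDeriv F b)}
termination_by a

/-- The Cantor-Bendixson index of a compact family: the least `a` with `∂⁽ᵃ⁾ F ⊆ {∅}`. -/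
def cbIndex (F : Set (Finset ℕ)) : Ordinal.{0} := sInf {a | iterDeriv F a ⊆ {∅}}

/-! ### The Tsirelson type norm -/

/-- `t = {m₁ < ⋯ < m_d}` interpolates the block sequence `E₁ < ⋯ < E_d` of nonempty finite sets,
where the set `E_i` is written `E m_i`:
`m₁ ≤ min E₁ ≤ max E₁ < m₂ ≤ min E₂ ≤ ⋯ < m_d ≤ min E_d`.
The sequence is `F`-admissible if some `t ∈ F` interpolates it. -/
def Interpolates (t : Finset ℕ) (E : ℕ → Finset ℕ) : Prop :=
  ∀ m ∈ t, (E m).Nonempty ∧ ∀ k ∈ E m, m ≤ k ∧ ∀ m' ∈ t, m < m' → k < m'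

/-- The norming set `K(F, θ)`: the smallest subset of `c₀₀` that contains `± e_n^*` and contains
`θ (f₁ + ⋯ + f_d)` for every `F`-admissible sequence `f₁, …, f_d` of its elements. -/
inductive NormingSet (F : Set (Finset ℕ)) (θ : ℝ) : (ℕ →₀ ℝ) → Prop
  | pos (n : ℕ) : NormingSet F θ (Finsupp.single n 1)
  | neg (n : ℕ) : NormingSet F θ (Finsupp.single n (-1))
  | op (t : Finset ℕ) (ht : t ∈ F) (g : ℕ → ℕ →₀ ℝ) (hg : ∀ m ∈ t, NormingSet F θ (g m))
      (hadm : Interpolates t fun m => (g m).support) :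
      NormingSet F θ (θ • ∑ m ∈ t, g m)

/-- The action `f(x) = ∑ₙ f(n) x(n)` of `f ∈ c₀₀` on `x ∈ c₀₀`. -/
def pair (f x : ℕ →₀ ℝ) : ℝ := f.sum fun n c => c * x n

/-- The norm `‖x‖_{(F, θ)} = sup {f(x) : f ∈ K(F, θ)}`. For hereditary `F` it is the one and only
solution of the implicit equation
`‖x‖ = max (‖x‖_∞, sup {θ ∑ ‖E_i x‖ : (E_i) is F-admissible})`:
see `tNorm_implicit` and `tNorm_unique` below. -/
def tNorm (F : Set (Finset ℕ)) (θ : ℝ) (x : ℕ →₀ ℝ) : ℝ :=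
  sSup {r | ∃ f, NormingSet F θ f ∧ r = pair f x}

theorem pair_add (f x y : ℕ →₀ ℝ) : pair f (x + y) = pair f x + pair f y := by
  simp [pair, Finsupp.sum, mul_add, Finset.sum_add_distrib]

theorem pair_smul (f : ℕ →₀ ℝ) (c : ℝ) (x : ℕ →₀ ℝ) : pair f (c • x) = c * pair f x := by
  simp only [pair, Finsupp.sum, Finsupp.smul_apply, smul_eq_mul, Finset.mul_sum]
  exact Finset.sum_congr rfl fun _ _ => by ring

theorem pair_eq_sum (f x : ℕ →₀ ℝ) : pair f x = ∑ n ∈ x.support, f n * x n := by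
  unfold pair Finsupp.sum
  rw [← Finset.sum_subset (Finset.inter_subset_left : f.support ∩ x.support ⊆ f.support),
    ← Finset.sum_subset (Finset.inter_subset_right : f.support ∩ x.support ⊆ x.support)]
  · intro n hn hn'
    have : f n = 0 := by
      by_contra h
      exact hn' (Finset.mem_inter.2 ⟨Finsupp.mem_support_iff.2 h, hn⟩)
    simp [this]
  · intro n hn hn'
    have : x n = 0 := by
      by_contra h
      exact hn' (Finset.mem_inter.2 ⟨hn, Finsupp.mem_support_iff.2 h⟩)
    simp [this]

theorem pair_comm (f x : ℕ →₀ ℝ) : pair f x = pair x f := by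
  rw [pair_eq_sum]
  exact Finset.sum_congr rfl fun _ _ => mul_comm _ _

theorem pair_single (n : ℕ) (c : ℝ) (x : ℕ →₀ ℝ) : pair (Finsupp.single n c) x = c * x n := by
  simp [pair]

theorem pair_op (θ : ℝ) (t : Finset ℕ) (g : ℕ → ℕ →₀ ℝ) (x : ℕ →₀ ℝ) :
    pair (θ • ∑ m ∈ t, g m) x = θ * ∑ m ∈ t, pair (g m) x := by
  rw [pair_eq_sum]
  simp only [pair_eq_sum, Finsupp.smul_apply, Finsupp.finsetSum_apply, smul_eq_mul,
    Finset.mul_sum, Finset.sum_mul]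
  rw [Finset.sum_comm]
  exact Finset.sum_congr rfl fun _ _ => Finset.sum_congr rfl fun _ _ => by ring

variable {F : Set (Finset ℕ)} {θ : ℝ}

/-- The sets in an interpolated sequence are pairwise disjoint. -/
theorem Interpolates.unique {t : Finset ℕ} {E : ℕ → Finset ℕ} (h : Interpolates t E)
    {m m' k : ℕ} (hm : m ∈ t) (hm' : m' ∈ t) (hk : k ∈ E m) (hk' : k ∈ E m') : m = m' := by
  rcases lt_trichotomy m m' with hlt | heq | hlt
  · have h1 := ((h m hm).2 k hk).2 m' hm' hlt
    have h2 := ((h m' hm').2 k hk').1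
    omega
  · exact heq
  · have h1 := ((h m' hm').2 k hk').2 m hm hlt
    have h2 := ((h m hm).2 k hk).1
    omega

theorem NormingSet.abs_le_one (h0 : 0 < θ) (h1 : θ < 1) {f : ℕ →₀ ℝ} (hf : NormingSet F θ f)
    (k : ℕ) : |f k| ≤ 1 := by
  induction hf with
  | pos n => by_cases h : n = k <;> simp [h]
  | neg n => by_cases h : n = k <;> simp [h]
  | op t ht g hg hadm ih =>
    simp only [Finsupp.smul_apply, Finsupp.finsetSum_apply, smul_eq_mul]
    rw [abs_mul, abs_of_pos h0]
    have key : |∑ m ∈ t, g m k| ≤ 1 := by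
      by_cases hex : ∃ m ∈ t, g m k ≠ 0
      · obtain ⟨m, hm, hmk⟩ := hex
        rw [Finset.sum_eq_single_of_mem m hm]
        · exact ih m hm
        · intro m' hm' hne
          by_contra hk'
          exact hne (hadm.unique hm' hm (Finsupp.mem_support_iff.2 hk')
            (Finsupp.mem_support_iff.2 hmk))
      · push Not at hex
        rw [Finset.sum_eq_zero hex]
        simp
    nlinarith [abs_nonneg (∑ m ∈ t, g m k)]

theorem NormingSet.neg_mem {f : ℕ →₀ ℝ} (hf : NormingSet F θ f) : NormingSet F θ (-f) := by
  induction hf with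
  | pos n => rw [← Finsupp.single_neg]; exact .neg n
  | neg n => rw [← Finsupp.single_neg, neg_neg]; exact .pos n
  | op t ht g hg hadm ih =>
    rw [← smul_neg, ← Finset.sum_neg_distrib]
    exact .op t ht (fun m => -g m) ih (by simpa only [Finsupp.support_neg] using hadm)

theorem pair_le_sum (h0 : 0 < θ) (h1 : θ < 1) {f : ℕ →₀ ℝ} (hf : NormingSet F θ f)
    (x : ℕ →₀ ℝ) : pair f x ≤ ∑ n ∈ x.support, |x n| := by
  rw [pair_eq_sum]
  refine Finset.sum_le_sum fun n _ => (le_abs_self _).trans ?_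
  rw [abs_mul]
  exact mul_le_of_le_one_left (abs_nonneg _) (hf.abs_le_one h0 h1 n)

theorem bddAbove_pair (h0 : 0 < θ) (h1 : θ < 1) (x : ℕ →₀ ℝ) :
    BddAbove {r | ∃ f, NormingSet F θ f ∧ r = pair f x} :=
  ⟨_, by rintro _ ⟨f, hf, rfl⟩; exact pair_le_sum h0 h1 hf x⟩

theorem nonempty_pair (x : ℕ →₀ ℝ) : {r | ∃ f, NormingSet F θ f ∧ r = pair f x}.Nonempty :=
  ⟨_, _, .pos 0, rfl⟩

theorem pair_le_tNorm (h0 : 0 < θ) (h1 : θ < 1) {f : ℕ →₀ ℝ} (hf : NormingSet F θ f)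
    (x : ℕ →₀ ℝ) : pair f x ≤ tNorm F θ x :=
  le_csSup (bddAbove_pair h0 h1 x) ⟨f, hf, rfl⟩

theorem tNorm_le {x : ℕ →₀ ℝ} {r : ℝ} (h : ∀ f, NormingSet F θ f → pair f x ≤ r) :
    tNorm F θ x ≤ r :=
  csSup_le (nonempty_pair x) (by rintro _ ⟨f, hf, rfl⟩; exact h f hf)

theorem abs_apply_le_tNorm (h0 : 0 < θ) (h1 : θ < 1) (x : ℕ →₀ ℝ) (n : ℕ) :
    |x n| ≤ tNorm F θ x := by
  have hp := pair_le_tNorm h0 h1 (NormingSet.pos (F := F) n) x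
  have hn := pair_le_tNorm h0 h1 (NormingSet.neg (F := F) n) x
  rw [pair_single] at hp hn
  rw [abs_le]
  constructor <;> linarith

theorem tNorm_nonneg (h0 : 0 < θ) (h1 : θ < 1) (x : ℕ →₀ ℝ) : 0 ≤ tNorm F θ x :=
  (abs_nonneg _).trans (abs_apply_le_tNorm h0 h1 x 0)

theorem tNorm_add_le (h0 : 0 < θ) (h1 : θ < 1) (x y : ℕ →₀ ℝ) :
    tNorm F θ (x + y) ≤ tNorm F θ x + tNorm F θ y :=
  tNorm_le fun f hf => by
    rw [pair_add]
    exact add_le_add (pair_le_tNorm h0 h1 hf x) (pair_le_tNorm h0 h1 hf y)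

theorem tNorm_smul_le (h0 : 0 < θ) (h1 : θ < 1) (c : ℝ) (x : ℕ →₀ ℝ) :
    tNorm F θ (c • x) ≤ |c| * tNorm F θ x :=
  tNorm_le fun f hf => by
    rw [pair_smul]
    have hp := pair_le_tNorm h0 h1 hf x
    have hn := pair_le_tNorm h0 h1 hf.neg_mem x
    rw [pair_comm, ← neg_one_smul ℝ f, pair_smul, pair_comm] at hn
    have : |pair f x| ≤ tNorm F θ x := abs_le.2 ⟨by linarith, hp⟩
    calc c * pair f x ≤ |c * pair f x| := le_abs_self _
      _ = |c| * |pair f x| := abs_mul _ _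
      _ ≤ |c| * tNorm F θ x := by gcongr

theorem tNorm_smul (h0 : 0 < θ) (h1 : θ < 1) (c : ℝ) (x : ℕ →₀ ℝ) :
    tNorm F θ (c • x) = |c| * tNorm F θ x := by
  refine le_antisymm (tNorm_smul_le h0 h1 c x) ?_
  rcases eq_or_ne c 0 with rfl | hc
  · simpa using tNorm_nonneg h0 h1 ((0 : ℝ) • x)
  · have h := tNorm_smul_le (F := F) h0 h1 c⁻¹ (c • x)
    rw [smul_smul, inv_mul_cancel₀ hc, one_smul, abs_inv] at h
    have hpos : 0 < |c| := abs_pos.2 hc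
    calc |c| * tNorm F θ x ≤ |c| * (|c|⁻¹ * tNorm F θ (c • x)) := by gcongr
      _ = tNorm F θ (c • x) := by field_simp

theorem eq_zero_of_tNorm (h0 : 0 < θ) (h1 : θ < 1) {x : ℕ →₀ ℝ} (h : tNorm F θ x = 0) :
    x = 0 := by
  ext n
  have := abs_apply_le_tNorm (F := F) h0 h1 x n
  rw [h] at this
  simpa using this

/-! ### The implicit equation -/

/-- The restriction `E x` of a vector to a set of integers. -/
def restrict (E : Finset ℕ) (x : ℕ →₀ ℝ) : ℕ →₀ ℝ := x.filter (· ∈ E)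

/-- The numbers of which the implicit equation takes the supremum: the coordinates `|x(n)|`, and
`θ ∑ p(E_i x)` over the `F`-admissible sequences `(E_i)`. -/
def implicitSet (F : Set (Finset ℕ)) (θ : ℝ) (p : (ℕ →₀ ℝ) → ℝ) (x : ℕ →₀ ℝ) : Set ℝ :=
  {r | ∃ n, r = |x n|} ∪
    {r | ∃ t ∈ F, ∃ E : ℕ → Finset ℕ, Interpolates t E ∧ r = θ * ∑ m ∈ t, p (restrict (E m) x)}

theorem restrict_apply (E : Finset ℕ) (x : ℕ →₀ ℝ) (n : ℕ) :
    restrict E x n = if n ∈ E then x n else 0 := by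
  simp [restrict, Finsupp.filter_apply]

theorem support_restrict (E : Finset ℕ) (x : ℕ →₀ ℝ) : (restrict E x).support ⊆ E := by
  intro n hn
  by_contra h
  exact Finsupp.mem_support_iff.1 hn (by simp [restrict_apply, h])

theorem pair_eq_of_subset {S : Finset ℕ} {f : ℕ →₀ ℝ} (h : f.support ⊆ S) (x : ℕ →₀ ℝ) :
    pair f x = ∑ n ∈ S, f n * x n :=
  Finsupp.sum_of_support_subset f h _ (by simp)

theorem pair_restrict (E : Finset ℕ) (f x : ℕ →₀ ℝ) :
    pair f (restrict E x) = pair (restrict E f) x := by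
  have h : (restrict E f).support ⊆ f.support := by
    intro n hn
    rw [Finsupp.mem_support_iff, restrict_apply] at hn
    rw [Finsupp.mem_support_iff]
    intro h0
    simp [h0] at hn
  rw [pair_eq_of_subset (Finset.Subset.refl _), pair_eq_of_subset h]
  refine Finset.sum_congr rfl fun n _ => ?_
  rw [restrict_apply, restrict_apply]
  split_ifs <;> simp

theorem restrict_single (E : Finset ℕ) (n : ℕ) (c : ℝ) :
    restrict E (Finsupp.single n c) = 0 ∨ restrict E (Finsupp.single n c) = Finsupp.single n c := by
  by_cases h : n ∈ E
  · right
    exact Finsupp.filter_single_of_pos _ h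
  · left
    exact Finsupp.filter_single_of_neg _ h

theorem restrict_op (E : Finset ℕ) (θ : ℝ) (t : Finset ℕ) (g : ℕ → ℕ →₀ ℝ) :
    restrict E (θ • ∑ m ∈ t, g m) = θ • ∑ m ∈ t, restrict E (g m) := by
  ext n
  simp only [restrict_apply, Finsupp.smul_apply, Finsupp.finsetSum_apply, smul_eq_mul]
  split_ifs <;> simp

/-- Dropping the terms that vanish from an admissible sequence. -/
theorem NormingSet.op_of_or (hF : IsHereditary F) {t : Finset ℕ} (ht : t ∈ F)
    {E : ℕ → Finset ℕ} (hE : Interpolates t E) {g : ℕ → ℕ →₀ ℝ}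
    (hg : ∀ m ∈ t, g m = 0 ∨ NormingSet F θ (g m)) (hs : ∀ m ∈ t, (g m).support ⊆ E m) :
    NormingSet F θ (θ • ∑ m ∈ t, g m) := by
  classical
  have hsum : ∑ m ∈ t, g m = ∑ m ∈ t.filter (fun m => g m ≠ 0), g m := by
    rw [Finset.sum_filter_ne_zero]
  rw [hsum]
  refine .op _ (hF t ht _ (Finset.filter_subset _ _)) g (fun m hm => ?_) (fun m hm => ?_)
  · rw [Finset.mem_filter] at hm
    exact (hg m hm.1).resolve_left hm.2
  · rw [Finset.mem_filter] at hm
    refine ⟨Finsupp.support_nonempty_iff.2 hm.2, fun k hk => ?_⟩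
    have := (hE m hm.1).2 k (hs m hm.1 hk)
    exact ⟨this.1, fun m' hm' => this.2 m' (Finset.mem_filter.1 hm').1⟩

theorem NormingSet.restrict_mem (hF : IsHereditary F) (E : Finset ℕ) {f : ℕ →₀ ℝ}
    (hf : NormingSet F θ f) : restrict E f = 0 ∨ NormingSet F θ (restrict E f) := by
  induction hf with
  | pos n => exact (restrict_single E n 1).imp_right fun h => by rw [h]; exact .pos n
  | neg n => exact (restrict_single E n (-1)).imp_right fun h => by rw [h]; exact .neg n
  | op t ht g hg hadm ih =>
    right
    rw [restrict_op]
    refine NormingSet.op_of_or hF ht hadm ih fun m _ n hn => ?_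
    rw [Finsupp.mem_support_iff, restrict_apply] at hn
    rw [Finsupp.mem_support_iff]
    intro h0
    simp [h0] at hn

theorem pair_eq_pair_restrict_support (f x : ℕ →₀ ℝ) :
    pair f x = pair f (restrict f.support x) := by
  unfold pair
  refine Finset.sum_congr rfl fun n hn => ?_
  simp only [restrict_apply, hn, if_true]

theorem mul_sum_tNorm_le (h0 : 0 < θ) (h1 : θ < 1) (hF : IsHereditary F) {t : Finset ℕ}
    (ht : t ∈ F) {E : ℕ → Finset ℕ} (hE : Interpolates t E) (x : ℕ →₀ ℝ) :
    θ * ∑ m ∈ t, tNorm F θ (restrict (E m) x) ≤ tNorm F θ x := by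
  refine le_of_forall_pos_le_add fun ε hε => ?_
  set δ : ℝ := ε / (t.card + 1) with hδ
  have hc : (0 : ℝ) < t.card + 1 := by positivity
  have hδ0 : 0 < δ := by positivity
  have hex : ∀ m, ∃ f, NormingSet F θ f ∧
      tNorm F θ (restrict (E m) x) - δ < pair f (restrict (E m) x) := fun m => by
    obtain ⟨_, ⟨f, hf, rfl⟩, hlt⟩ :=
      exists_lt_of_lt_csSup (nonempty_pair (F := F) (θ := θ) (restrict (E m) x))
        (sub_lt_self (tNorm F θ (restrict (E m) x)) hδ0)
    exact ⟨f, hf, hlt⟩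
  choose f hf hlt using hex
  have hmem : NormingSet F θ (θ • ∑ m ∈ t, restrict (E m) (f m)) :=
    NormingSet.op_of_or hF ht hE (fun m _ => (hf m).restrict_mem hF (E m))
      fun m _ => support_restrict _ _
  have hle := pair_le_tNorm h0 h1 hmem x
  rw [pair_op] at hle
  have hsum : ∑ m ∈ t, tNorm F θ (restrict (E m) x) ≤
      ∑ m ∈ t, pair (restrict (E m) (f m)) x + t.card * δ := by
    rw [← nsmul_eq_mul, ← Finset.sum_const, ← Finset.sum_add_distrib]
    refine Finset.sum_le_sum fun m _ => ?_
    have := hlt m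
    rw [pair_restrict] at this
    linarith
  have hcard : t.card * δ ≤ ε := by
    rw [hδ, mul_div_assoc', div_le_iff₀ hc]
    nlinarith
  have hcard0 : 0 ≤ t.card * δ := by positivity
  calc θ * ∑ m ∈ t, tNorm F θ (restrict (E m) x)
      ≤ θ * (∑ m ∈ t, pair (restrict (E m) (f m)) x + t.card * δ) := by gcongr
    _ = θ * ∑ m ∈ t, pair (restrict (E m) (f m)) x + θ * (t.card * δ) := by ring
    _ ≤ tNorm F θ x + ε := by nlinarith

/-- The norm solves the implicit equation
`‖x‖ = max (‖x‖_∞, sup {θ ∑ ‖E_i x‖ : (E_i) is F-admissible})`. -/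
theorem tNorm_implicit (h0 : 0 < θ) (h1 : θ < 1) (hF : IsHereditary F) (x : ℕ →₀ ℝ) :
    IsLUB (implicitSet F θ (tNorm F θ) x) (tNorm F θ x) := by
  constructor
  · rintro r (⟨n, rfl⟩ | ⟨t, ht, E, hE, rfl⟩)
    · exact abs_apply_le_tNorm h0 h1 x n
    · exact mul_sum_tNorm_le h0 h1 hF ht hE x
  · intro b hb
    refine tNorm_le fun f hf => ?_
    cases hf with
    | pos n =>
      rw [pair_single, one_mul]
      exact (le_abs_self _).trans (hb (.inl ⟨n, rfl⟩))
    | neg n =>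
      rw [pair_single, neg_one_mul]
      exact (neg_le_abs _).trans (hb (.inl ⟨n, rfl⟩))
    | op t ht g hg hadm =>
      rw [pair_op]
      refine le_trans ?_ (hb (.inr ⟨t, ht, _, hadm, rfl⟩))
      refine mul_le_mul_of_nonneg_left (Finset.sum_le_sum fun m hm => ?_) h0.le
      rw [pair_eq_pair_restrict_support]
      exact pair_le_tNorm h0 h1 (hg m hm) _

/-- The implicit equation has no other solution that vanishes at `0`. -/
theorem tNorm_unique (h0 : 0 < θ) (h1 : θ < 1) (hF : IsHereditary F) (p : (ℕ →₀ ℝ) → ℝ)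
    (hp0 : p 0 = 0) (hp : ∀ x, IsLUB (implicitSet F θ p x) (p x)) : p = tNorm F θ := by
  have hge : ∀ f, NormingSet F θ f → ∀ x, pair f x ≤ p x := by
    intro f hf
    induction hf with
    | pos n =>
      intro x
      rw [pair_single, one_mul]
      exact (le_abs_self _).trans ((hp x).1 (.inl ⟨n, rfl⟩))
    | neg n =>
      intro x
      rw [pair_single, neg_one_mul]
      exact (neg_le_abs _).trans ((hp x).1 (.inl ⟨n, rfl⟩))
    | op t ht g hg hadm ih =>
      intro x
      rw [pair_op]
      refine le_trans ?_ ((hp x).1 (.inr ⟨t, ht, _, hadm, rfl⟩))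
      refine mul_le_mul_of_nonneg_left (Finset.sum_le_sum fun m hm => ?_) h0.le
      rw [pair_eq_pair_restrict_support]
      exact ih m hm _
  have hle : ∀ k : ℕ, ∀ x : ℕ →₀ ℝ, x.support.card = k → p x ≤ tNorm F θ x := by
    intro k
    induction k using Nat.strong_induction_on with
    | _ k ih =>
      intro x hx
      by_contra! hlt
      have hpos : 0 < p x := (tNorm_nonneg h0 h1 x).trans_lt hlt
      have hub : max (tNorm F θ x) (θ * p x) ∈ upperBounds (implicitSet F θ p x) := by
        rintro r (⟨n, rfl⟩ | ⟨t, ht, E, hE, rfl⟩)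
        · exact le_max_of_le_left (abs_apply_le_tNorm h0 h1 x n)
        · by_cases hbig : ∃ m ∈ t, restrict (E m) x = x
          · obtain ⟨m, hm, hmx⟩ := hbig
            refine le_max_of_le_right (mul_le_mul_of_nonneg_left ?_ h0.le)
            rw [Finset.sum_eq_single_of_mem m hm, hmx]
            intro m' hm' hne
            have hz : restrict (E m') x = 0 := by
              ext n
              rw [restrict_apply, Finsupp.zero_apply]
              split_ifs with hn
              · by_contra hxn
                have hn' : n ∈ E m := by
                  by_contra hnot
                  rw [← hmx, restrict_apply, if_neg hnot] at hxn
                  exact hxn rfl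
                exact hne (hE.unique hm' hm hn hn')
              · rfl
            rw [hz, hp0]
          · push Not at hbig
            refine le_max_of_le_left (le_trans ?_ (mul_sum_tNorm_le h0 h1 hF ht hE x))
            refine mul_le_mul_of_nonneg_left (Finset.sum_le_sum fun m hm => ?_) h0.le
            refine ih _ ?_ _ rfl
            rw [← hx]
            refine Finset.card_lt_card (Finset.ssubset_iff_subset_ne.2 ⟨?_, ?_⟩)
            · intro n hn
              rw [Finsupp.mem_support_iff, restrict_apply] at hn
              rw [Finsupp.mem_support_iff]
              intro hz
              simp [hz] at hn
            · intro heq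
              refine hbig m hm ?_
              ext n
              rw [restrict_apply]
              split_ifs with hn
              · rfl
              · by_contra hxn
                have : n ∈ x.support := Finsupp.mem_support_iff.2 (Ne.symm hxn)
                rw [← heq] at this
                exact hn (support_restrict _ _ this)
      have := (hp x).2 hub
      rcases le_max_iff.1 this with h | h <;> nlinarith
  funext x
  exact le_antisymm (hle _ x rfl) (tNorm_le fun f hf => hge f hf x)

/-! ### The space `T(F, θ)` -/

/-- The space `c₀₀` of finitely supported real sequences, to be normed by `‖·‖_{(F, θ)}`. -/
def C00 (_F : Set (Finset ℕ)) (_θ : Set.Ioo (0 : ℝ) 1) : Type := ℕ →₀ ℝ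

instance (F : Set (Finset ℕ)) (θ : Set.Ioo (0 : ℝ) 1) : AddCommGroup (C00 F θ) :=
  inferInstanceAs (AddCommGroup (ℕ →₀ ℝ))

instance (F : Set (Finset ℕ)) (θ : Set.Ioo (0 : ℝ) 1) : Module ℝ (C00 F θ) :=
  inferInstanceAs (Module ℝ (ℕ →₀ ℝ))

instance (F : Set (Finset ℕ)) (θ : Set.Ioo (0 : ℝ) 1) : Norm (C00 F θ) :=
  ⟨fun x => tNorm F (θ : ℝ) x⟩

theorem c00_core (F : Set (Finset ℕ)) (θ : Set.Ioo (0 : ℝ) 1) :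
    NormedSpace.Core ℝ (C00 F θ) where
  norm_nonneg x := tNorm_nonneg θ.2.1 θ.2.2 x
  norm_smul c x := tNorm_smul θ.2.1 θ.2.2 c x
  norm_triangle x y := tNorm_add_le θ.2.1 θ.2.2 x y
  norm_eq_zero_iff x :=
    ⟨fun h => eq_zero_of_tNorm θ.2.1 θ.2.2 h, fun h => by
      subst h
      have := tNorm_smul (F := F) θ.2.1 θ.2.2 0 0
      rw [zero_smul, abs_zero, zero_mul] at this
      exact this⟩

instance (F : Set (Finset ℕ)) (θ : Set.Ioo (0 : ℝ) 1) : NormedAddCommGroup (C00 F θ) :=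
  NormedAddCommGroup.ofCore (c00_core F θ)

instance (F : Set (Finset ℕ)) (θ : Set.Ioo (0 : ℝ) 1) : NormedSpace ℝ (C00 F θ) :=
  NormedSpace.ofCore (c00_core F θ)

/-- The Tsirelson type space `T(F, θ)`: the completion of `c₀₀` in the norm `‖·‖_{(F, θ)}`. -/
abbrev TSpace (F : Set (Finset ℕ)) (θ : Set.Ioo (0 : ℝ) 1) : Type :=
  UniformSpace.Completion (C00 F θ)

/-- The natural basis `(e_n)` of `T(F, θ)`. -/
def basisVec (F : Set (Finset ℕ)) (θ : Set.Ioo (0 : ℝ) 1) (n : ℕ) : TSpace F θ :=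
  UniformSpace.Completion.coe' (α := C00 F θ) (Finsupp.single n (1 : ℝ) : ℕ →₀ ℝ)

/-- In `T(F, θ)` the norm of `∑ aₙ eₙ` is `‖(aₙ)‖_{(F, θ)}`. -/
theorem norm_sum_basisVec (F : Set (Finset ℕ)) (θ : Set.Ioo (0 : ℝ) 1) (a : ℕ →₀ ℝ) :
    ‖a.sum fun n c => c • basisVec F θ n‖ = tNorm F (θ : ℝ) a := by
  have h : (a.sum fun n c => c • basisVec F θ n) =
      UniformSpace.Completion.coe' (α := C00 F θ) a := by
    induction a using Finsupp.induction_linear with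
    | zero => exact UniformSpace.Completion.coe_zero.symm
    | add f g hf hg =>
      rw [Finsupp.sum_add_index' (by simp) (by intros; rw [add_smul]), hf, hg]
      exact (UniformSpace.Completion.coe_add (α := C00 F θ) f g).symm
    | single n c =>
      rw [Finsupp.sum_single_index (by simp)]
      refine (UniformSpace.Completion.coe_smul (X := C00 F θ) c _).symm.trans ?_
      exact congrArg (UniformSpace.Completion.coe' (α := C00 F θ)) (Finsupp.smul_single_one n c)
  rw [h]
  exact UniformSpace.Completion.norm_coe (E := C00 F θ) a

/-- Two sequences in normed spaces are equivalent: for some `C ≥ 1`, all finite linear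
combinations satisfy `C⁻¹ ‖∑ aᵢ yᵢ‖ ≤ ‖∑ aᵢ xᵢ‖ ≤ C ‖∑ aᵢ yᵢ‖`. -/
def EquivalentSeq {ι X Y : Type*} [NormedAddCommGroup X] [NormedSpace ℝ X]
    [NormedAddCommGroup Y] [NormedSpace ℝ Y] (x : ι → X) (y : ι → Y) : Prop :=
  ∃ C : ℝ, 1 ≤ C ∧ ∀ a : ι →₀ ℝ,
    C⁻¹ * ‖a.sum fun i c => c • y i‖ ≤ ‖a.sum fun i c => c • x i‖ ∧
      ‖a.sum fun i c => c • x i‖ ≤ C * ‖a.sum fun i c => c • y i‖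

end

end Tsirelson

namespace Tsirelson

open Filter

noncomputable section

/-! ### The spreading order -/

/-! The index of a hereditary spreading family is the rank of its tree of end-extensions, and on
sufficiently sparse sets ranks decide inclusions. If the rank of `F` is below that of `G`, then `F ⊆
G` there (`exists_gap_forall_mem`); if it is only at most that of `G`, a member of `F` lies in `G`
after its minimum is removed (`exists_gap_forall_erase_mem`). Since `ω ^ α < ω ^ (α + β)`, the first
comparison puts `B₁` inside `B₀` on `N` and gives one inequality with constant 1.

For the other inequality, let `C` be a family of rank `ω ^ β`. Ranks of products multiply, so
`tensor (addMin C) B₀` has rank at most `(ω ^ β + 1) * ω ^ (α + β) ≤ ω ^ (β + α + β) = ω ^ α * ω ^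
β`, by `β + α = α`, and this is a lower bound for the rank of `tensor B₁ C`. Hence on sparse sets a
`B₀`-admissible family of `C`-admissible families can be regrouped, up to a minimum, as a
`C`-admissible family of `B₁`-admissible ones.

Induction over `K(B₀, θ)` (`exists_pair_le_sum`) then bounds `f(x)` by a sum of `T(B₁, θ)`-norms of
consecutive pieces of `x` whose starting points form a member of `addMin C`. In the step `f = θ (g₁
+ ⋯ + g_d)` the pieces of all the `g_j` are regrouped. The single factor `θ` is spent on the
`B₁`-admissible groups, so no constant accumulates and the outer family is again `addMin C`. Finally
`ω ^ β < ω ^ α` gives `C ⊆ B₁` on `N`, so the outer sum costs only the factor `1 + θ⁻¹`. -/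

theorem SpreadLE.exists_map {s t : Finset ℕ} (h : SpreadLE s t) :
    ∃ φ : ℕ → ℕ, StrictMonoOn φ s ∧ (∀ m ∈ s, m ≤ φ m) ∧ t = s.image φ := by
  classical
  obtain ⟨hc, hle⟩ := h
  have hval : ∀ m (hm : m ∈ s), s.orderEmbOfFin rfl ((s.orderIsoOfFin rfl).symm ⟨m, hm⟩) = m := by
    intro m hm
    rw [← Finset.coe_orderIsoOfFin_apply, OrderIso.apply_symm_apply]
  let φ : ℕ → ℕ := fun m => if hm : m ∈ s then
    t.orderEmbOfFin hc ((s.orderIsoOfFin rfl).symm ⟨m, hm⟩) else 0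
  have hφ : ∀ m (hm : m ∈ s), φ m = t.orderEmbOfFin hc ((s.orderIsoOfFin rfl).symm ⟨m, hm⟩) :=
    fun m hm => dif_pos hm
  have hmono : StrictMonoOn φ s := by
    intro a ha b hb hab
    rw [hφ a ha, hφ b hb]
    exact (t.orderEmbOfFin hc).strictMono ((s.orderIsoOfFin rfl).symm.strictMono hab)
  refine ⟨φ, hmono, fun m hm => ?_, ?_⟩
  · rw [hφ m hm]
    exact (hval m hm).symm.le.trans (hle _)
  · refine (Finset.eq_of_subset_of_card_le ?_ ?_).symm
    · intro k hk
      obtain ⟨m, hm, rfl⟩ := Finset.mem_image.1 hk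
      rw [hφ m hm]
      exact Finset.orderEmbOfFin_mem _ _ _
    · rw [Finset.card_image_of_injOn hmono.injOn, hc]

theorem SpreadLE.of_map {s : Finset ℕ} {φ : ℕ → ℕ} (hφ : StrictMonoOn φ s)
    (hle : ∀ m ∈ s, m ≤ φ m) : SpreadLE s (s.image φ) := by
  have hc : (s.image φ).card = s.card := Finset.card_image_of_injOn hφ.injOn
  refine ⟨hc, fun i => ?_⟩
  have h := Finset.orderEmbOfFin_unique hc (f := fun i => φ (s.orderEmbOfFin rfl i))
    (fun i => Finset.mem_image_of_mem _ (Finset.orderEmbOfFin_mem _ _ _))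
    (fun i j hij => hφ (Finset.orderEmbOfFin_mem _ _ _) (Finset.orderEmbOfFin_mem _ _ _)
      ((s.orderEmbOfFin rfl).strictMono hij))
  rw [← congrFun h i]
  exact hle _ (Finset.orderEmbOfFin_mem _ _ _)

theorem SpreadLE.insert_max {s t : Finset ℕ} (h : SpreadLE s t) {n n' : ℕ} (hn : ∀ k ∈ s, k < n)
    (hn' : ∀ k ∈ t, k < n') (hnn : n ≤ n') : SpreadLE (insert n s) (insert n' t) := by
  classical
  obtain ⟨φ, hφ, hle, rfl⟩ := h.exists_map
  have hns : n ∉ s := fun h => lt_irrefl _ (hn n h)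
  have hup : ∀ m ∈ s, Function.update φ n n' m = φ m := fun m hm =>
    Function.update_of_ne (ne_of_mem_of_not_mem hm hns) _ _
  have him : insert n' (s.image φ) = (insert n s).image (Function.update φ n n') := by
    rw [Finset.image_insert, Function.update_self]
    congr 1
    exact Finset.image_congr fun m hm => (hup m hm).symm
  rw [him]
  refine SpreadLE.of_map ?_ ?_
  · intro a ha b hb hab
    rw [Finset.coe_insert, Set.mem_insert_iff, Finset.mem_coe] at ha hb
    rcases ha with rfl | ha <;> rcases hb with rfl | hb
    · exact absurd hab (lt_irrefl _)
    · exact absurd hab (hn b hb).not_gt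
    · rw [hup a ha, Function.update_self]
      exact hn' _ (Finset.mem_image_of_mem _ ha)
    · rw [hup a ha, hup b hb]
      exact hφ ha hb hab
  · intro m hm
    rcases Finset.mem_insert.1 hm with rfl | hm
    · rwa [Function.update_self]
    · rw [hup m hm]
      exact hle m hm

theorem SpreadLE.refl (s : Finset ℕ) : SpreadLE s s :=
  ⟨rfl, fun _ => le_rfl⟩

theorem eventually_forall_lt (s : Finset ℕ) : ∀ᶠ n in atTop, ∀ k ∈ s, k < n :=
  s.eventually_all.2 fun k _ => eventually_gt_atTop k

/-! ### The rank of the tree of end-extensions -/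

/-- The rank of `t` in the tree `G`, ordered by end-extension, is at least `a`. -/
def RankGE (G : Set (Finset ℕ)) (a : Ordinal.{0}) (t : Finset ℕ) : Prop :=
  t ∈ G ∧ ∀ b, b < a → ∀ᶠ n in atTop, RankGE G b (insert n t)
termination_by a

theorem rankGE_iff {G : Set (Finset ℕ)} {a : Ordinal.{0}} {t : Finset ℕ} :
    RankGE G a t ↔ t ∈ G ∧ ∀ b < a, ∀ᶠ n in atTop, RankGE G b (insert n t) := by
  rw [RankGE]

theorem RankGE.mem {G : Set (Finset ℕ)} {a : Ordinal.{0}} {t : Finset ℕ} (h : RankGE G a t) :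
    t ∈ G := (rankGE_iff.1 h).1

theorem RankGE.eventually {G : Set (Finset ℕ)} {a b : Ordinal.{0}} {t : Finset ℕ}
    (h : RankGE G a t) (hb : b < a) : ∀ᶠ n in atTop, RankGE G b (insert n t) :=
  (rankGE_iff.1 h).2 b hb

theorem RankGE.mono {G : Set (Finset ℕ)} {a b : Ordinal.{0}} {t : Finset ℕ}
    (h : RankGE G a t) (hb : b ≤ a) : RankGE G b t :=
  rankGE_iff.2 ⟨h.mem, fun _ hc => h.eventually (hc.trans_le hb)⟩

theorem RankGE.spread {G : Set (Finset ℕ)} (hG : IsSpreading G) {a : Ordinal.{0}} :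
    ∀ {s t : Finset ℕ}, SpreadLE s t → RankGE G a s → RankGE G a t := by
  induction a using WellFoundedLT.induction with
  | _ a ih =>
    intro s t hst hs
    refine rankGE_iff.2 ⟨hG s hs.mem t hst, fun b hb => ?_⟩
    filter_upwards [hs.eventually hb, eventually_forall_lt s, eventually_forall_lt t]
      with n h1 h2 h3
    exact ih b hb (hst.insert_max h2 h3 le_rfl) h1

theorem RankGE.subset {G : Set (Finset ℕ)} (hG : IsHereditary G) {a : Ordinal.{0}} :
    ∀ {s t : Finset ℕ}, s ⊆ t → RankGE G a t → RankGE G a s := by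
  induction a using WellFoundedLT.induction with
  | _ a ih =>
    intro s t hst ht
    refine rankGE_iff.2 ⟨hG t ht.mem s hst, fun b hb => ?_⟩
    filter_upwards [ht.eventually hb] with n h1
    exact ih b hb (Finset.insert_subset_insert n hst) h1

theorem RankGE.eventually_insert {G : Set (Finset ℕ)} (hG : IsSpreading G) {a : Ordinal.{0}}
    {s : Finset ℕ} {n : ℕ} (hn : ∀ k ∈ s, k < n) (h : RankGE G a (insert n s)) :
    ∀ᶠ m in atTop, RankGE G a (insert m s) := by
  filter_upwards [eventually_ge_atTop n] with m hm
  exact h.spread hG ((SpreadLE.refl s).insert_max hn (fun k hk => (hn k hk).trans_le hm) hm)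

/-- A different member that agrees with `s` on a long initial interval must contain `s` and a
further point beyond that interval; heredity discards the rest. One such point suffices, since
spreading later turns it into all large ones. -/
theorem frequently_of_mem_derivFamily {G : Set (Finset ℕ)} (hG : IsHereditary G) {s : Finset ℕ}
    (h : s ∈ derivFamily G) : ∃ n, (∀ k ∈ s, k < n) ∧ insert n s ∈ G := by
  obtain ⟨L, hL⟩ := (eventually_forall_lt s).exists
  let U : Set (ℕ → Bool) := {x | ∀ k < L, x k = charFun s k}
  have hU : U ∈ nhds (charFun s) := by
    have : U = Set.pi (Finset.range L : Set ℕ) fun k => {charFun s k} := by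
      ext x
      simp [U, Set.mem_pi]
    rw [this]
    exact set_pi_mem_nhds (Finset.finite_toSet _) fun k _ => by simp
  obtain ⟨y, ⟨hyU, u, hu, rfl⟩, hne⟩ := accPt_iff_nhds.1 h U hU
  have hagree : ∀ k < L, (k ∈ u ↔ k ∈ s) := fun k hk => by
    simpa [charFun] using hyU k hk
  have hsu : s ⊆ u := fun k hk => (hagree k (hL k hk)).2 hk
  have hnot : ¬ u ⊆ s := fun hus => hne (by rw [Finset.Subset.antisymm hus hsu])
  obtain ⟨n, hnu, hns⟩ := Finset.not_subset.1 hnot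
  have hLn : L ≤ n := by
    by_contra! hlt
    exact hns ((hagree n hlt).1 hnu)
  exact ⟨n, fun k hk => (hL k hk).trans_le hLn,
    hG u hu _ (Finset.insert_subset hnu hsu)⟩

theorem mem_derivFamily_of_eventually {G : Set (Finset ℕ)} {s : Finset ℕ}
    (h : ∀ᶠ n in atTop, insert n s ∈ G) : s ∈ derivFamily G := by
  have htend : Tendsto (fun n => charFun (insert n s)) atTop (nhds (charFun s)) := by
    rw [tendsto_pi_nhds]
    intro k
    refine tendsto_const_nhds.congr' ?_
    filter_upwards [eventually_gt_atTop k] with n hn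
    simp [charFun, hn.ne]
  refine accPt_iff_frequently.2 (htend.frequently (Eventually.frequently ?_))
  filter_upwards [h, eventually_forall_lt s] with n hn hlt
  refine ⟨fun heq => ?_, Set.mem_image_of_mem _ hn⟩
  have := congrFun heq n
  have hns : n ∉ s := fun h => lt_irrefl _ (hlt n h)
  simp [charFun, hns] at this

/-- The topological derivative of a hereditary spreading family is purely combinatorial:
accumulating at `s` means that `s` can be extended by one, hence by every, large integer. By
induction each derivative is again hereditary and spreading. -/
theorem mem_iterDeriv_iff {F : Set (Finset ℕ)} (hh : IsHereditary F) (hs : IsSpreading F)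
    {a : Ordinal.{0}} : ∀ {s : Finset ℕ}, s ∈ iterDeriv F a ↔ RankGE F a s := by
  induction a using WellFoundedLT.induction with
  | _ a ih =>
    intro s
    rw [iterDeriv, rankGE_iff, Set.mem_ofPred_eq]
    refine and_congr_right fun _ => forall₂_congr fun b hb => ?_
    have heq : iterDeriv F b = {s | RankGE F b s} := Set.ext fun s => ih b hb
    rw [heq]
    constructor
    · intro h
      obtain ⟨n, hn, hmem⟩ := frequently_of_mem_derivFamily
        (fun t ht u hu => RankGE.subset hh hu ht) h
      exact RankGE.eventually_insert hs hn hmem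
    · exact mem_derivFamily_of_eventually

/-- Below the index some nonempty set survives; heredity shrinks it to a singleton and spreading
moves that singleton to all later ones, so the root has rank at least the index itself. -/
theorem rankGE_cbIndex {F : Set (Finset ℕ)} (hh : IsHereditary F) (hs : IsSpreading F)
    (hpos : 0 < cbIndex F) : RankGE F (cbIndex F) ∅ := by
  have key : ∀ b < cbIndex F, ∃ n, RankGE F b {n} := by
    intro b hb
    have hb' : ¬ iterDeriv F b ⊆ {∅} := notMem_of_lt_csInf' hb
    obtain ⟨s, hsb, hne⟩ := Set.not_subset.1 hb'
    obtain ⟨n, hn⟩ := Finset.nonempty_iff_ne_empty.2 hne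
    exact ⟨n, ((mem_iterDeriv_iff hh hs).1 hsb).subset hh (Finset.singleton_subset_iff.2 hn)⟩
  refine rankGE_iff.2 ⟨?_, fun b hb => ?_⟩
  · obtain ⟨n, hn⟩ := key 0 hpos
    exact hh _ hn.mem _ (Finset.empty_subset _)
  · obtain ⟨n, hn⟩ := key b hb
    exact RankGE.eventually_insert hs (s := ∅) (by simp) hn

theorem not_rankGE_succ_cbIndex {F : Set (Finset ℕ)} (hh : IsHereditary F) (hs : IsSpreading F)
    (hpos : 0 < cbIndex F) : ¬ RankGE F (Order.succ (cbIndex F)) ∅ := by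
  intro h
  -- The infimum of an empty set of ordinals is 0, so a positive index is a true minimum.
  have hne : {a | iterDeriv F a ⊆ {∅}}.Nonempty := by
    by_contra hemp
    rw [Set.not_nonempty_iff_eq_empty] at hemp
    rw [cbIndex, hemp, Ordinal.sInf_empty] at hpos
    exact lt_irrefl _ hpos
  obtain ⟨n, hn⟩ := (h.eventually (Order.lt_succ _)).exists
  have := csInf_mem hne ((mem_iterDeriv_iff hh hs).2 hn)
  simp at this

/-- `R` decreases strictly along the end-extensions in the tree `F`; thus `R ∅` is an upper bound
for its rank. -/
def DecreasesOn (F : Set (Finset ℕ)) (R : Finset ℕ → Ordinal.{0}) : Prop :=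
  ∀ s n, (∀ k ∈ s, k < n) → insert n s ∈ F → R (insert n s) < R s

/-- Closed under initial segments. -/
def IsInitClosed (F : Set (Finset ℕ)) : Prop :=
  ∀ s n, (∀ k ∈ s, k < n) → insert n s ∈ F → s ∈ F

theorem IsHereditary.isInitClosed {F : Set (Finset ℕ)} (hF : IsHereditary F) : IsInitClosed F :=
  fun _ n _ h => hF _ h _ (Finset.subset_insert n _)

/-- A regular family has an exact rank function. -/
theorem exists_rank {F : Set (Finset ℕ)} (hh : IsHereditary F) (hs : IsSpreading F)
    (hpos : 0 < cbIndex F) : ∃ R : Finset ℕ → Ordinal.{0}, DecreasesOn F R ∧ R ∅ = cbIndex F ∧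
      ∀ s a, RankGE F a s ↔ s ∈ F ∧ a ≤ R s := by
  have hne : ∀ s, ¬ RankGE F (Order.succ (cbIndex F)) s := fun s h =>
    not_rankGE_succ_cbIndex hh hs hpos (h.subset hh (Finset.empty_subset _))
  -- The successor makes `R s` the largest rank attained at `s`, not the first that fails; outside
  -- `F` the value is 0.
  let R : Finset ℕ → Ordinal.{0} := fun s => sInf {a | ¬ RankGE F (Order.succ a) s}
  have hR : ∀ s, ¬ RankGE F (Order.succ (R s)) s := fun s =>
    csInf_mem (s := {a | ¬ RankGE F (Order.succ a) s}) ⟨_, hne s⟩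
  have hge : ∀ s ∈ F, RankGE F (R s) s := fun s hsF =>
    rankGE_iff.2 ⟨hsF, fun b hb => by
      have h : RankGE F (Order.succ b) s := by
        by_contra hcon
        exact notMem_of_lt_csInf' hb hcon
      exact h.eventually (Order.lt_succ b)⟩
  have hiff : ∀ s a, RankGE F a s ↔ s ∈ F ∧ a ≤ R s := fun s a =>
    ⟨fun h => ⟨h.mem, by
      by_contra! hlt
      exact hR s (h.mono (Order.succ_le_of_lt hlt))⟩, fun h => (hge s h.1).mono h.2⟩
  refine ⟨R, fun s n hn hmem => ?_, le_antisymm ?_ ?_, hiff⟩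
  · by_contra! hle
    refine hR s (rankGE_iff.2 ⟨hh.isInitClosed s n hn hmem, fun b hb => ?_⟩)
    exact RankGE.eventually_insert hs hn
      ((hge _ hmem).mono ((Order.lt_succ_iff.1 hb).trans hle))
  · exact csInf_le' (hne ∅)
  · exact ((hiff _ _).1 (rankGE_cbIndex hh hs hpos)).2

/-- Every ordinal below the rank of a regular family is the rank of one of its nodes. -/
theorem exists_rank_eq {F : Set (Finset ℕ)} {R : Finset ℕ → Ordinal.{0}} (hR : DecreasesOn F R)
    (hiff : ∀ s a, RankGE F a s ↔ s ∈ F ∧ a ≤ R s) {a : Ordinal.{0}} (h0 : ∅ ∈ F)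
    (ha : a ≤ R ∅) : ∃ s ∈ F, R s = a := by
  have hne : (R '' {s | s ∈ F ∧ a ≤ R s}).Nonempty := ⟨_, ∅, ⟨h0, ha⟩, rfl⟩
  -- `s` has the least rank among the nodes of rank at least `a`. Were that rank larger than `a`, a
  -- one-point extension would still have rank at least `a`, but a smaller value of `R`.
  obtain ⟨s, ⟨hsF, has⟩, hmin⟩ := csInf_mem hne
  refine ⟨s, hsF, (has.eq_of_not_lt fun hlt => ?_).symm⟩
  obtain ⟨n, hn, hlt'⟩ := ((((hiff s _).2 ⟨hsF, le_rfl⟩).eventually hlt).and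
    (eventually_forall_lt s)).exists
  have h1 := hR s n hlt' hn.mem
  rw [hmin] at h1
  exact notMem_of_lt_csInf' h1 ⟨_, (hiff _ _).1 hn, rfl⟩

/-! ### Comparison of families by their ranks -/

/-- `N` is sparse with respect to the gap function `g`. -/
def IsSparse (g : ℕ → ℕ) (N : Set ℕ) : Prop := ∀ a ∈ N, ∀ b ∈ N, a < b → g a ≤ b

theorem IsSparse.mono {g h : ℕ → ℕ} {N : Set ℕ} (hN : IsSparse h N) (hgh : ∀ a, g a ≤ h a) :
    IsSparse g N := fun a ha b hb hab => (hgh a).trans (hN a ha b hb hab)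

theorem exists_isSparse_subset (g : ℕ → ℕ) {M : Set ℕ} (hM : M.Infinite) (L : ℕ) :
    ∃ N ⊆ M, N.Infinite ∧ IsSparse g N ∧ ∀ k ∈ N, L ≤ k := by
  have hex : ∀ k, ∃ m ∈ M, k < m := fun k => hM.exists_gt k
  choose p hpM hp using hex
  let u : ℕ → ℕ := fun i => Nat.rec (p L) (fun _ k => p (max k (g k))) i
  have hu : ∀ i, u (i + 1) = p (max (u i) (g (u i))) := fun _ => rfl
  have hmono : StrictMono u := strictMono_nat_of_lt_succ fun i => by
    rw [hu]
    exact (le_max_left _ _).trans_lt (hp _)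
  refine ⟨Set.range u, ?_, Set.infinite_range_of_injective hmono.injective, ?_, ?_⟩
  · rintro _ ⟨i, rfl⟩
    cases i <;> exact hpM _
  · rintro _ ⟨i, rfl⟩ _ ⟨j, rfl⟩ hij
    have hij' : i + 1 ≤ j := hmono.lt_iff_lt.1 hij
    refine le_trans ?_ (hmono.monotone hij')
    rw [hu]
    exact (le_max_right _ _).trans (hp _).le
  · rintro _ ⟨i, rfl⟩
    exact (hp L).le.trans (hmono.monotone (Nat.zero_le i))

/-- From `g a` on, all the extensions that preserve a prescribed rank are available for the
subsets of `{0, …, a}`. -/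
theorem exists_gap (R : Finset ℕ → Ordinal.{0}) (G : Set (Finset ℕ)) :
    ∃ g : ℕ → ℕ, ∀ a, ∀ s ⊆ Finset.range (a + 1), ∀ t ⊆ Finset.range (a + 1), ∀ b,
      RankGE G b t → R s < b → ∀ k, g a ≤ k → RankGE G (R s) (insert k t) := by
  have hex : ∀ a, ∃ L, ∀ k, L ≤ k → ∀ s ∈ (Finset.range (a + 1)).powerset,
      ∀ t ∈ (Finset.range (a + 1)).powerset, (∃ b, RankGE G b t ∧ R s < b) →
        RankGE G (R s) (insert k t) := by
    intro a
    refine eventually_atTop.1 ?_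
    -- Only finitely many pairs `s, t` occur, and the target rank `R s` does not depend on `b`; so
    -- finitely many thresholds have to be exceeded.
    refine (Finset.eventually_all _).2 fun s _ => (Finset.eventually_all _).2 fun t _ => ?_
    by_cases h : ∃ b, RankGE G b t ∧ R s < b
    · obtain ⟨b, hb, hlt⟩ := h
      filter_upwards [hb.eventually hlt] with k hk _
      exact hk
    · exact Eventually.of_forall fun k hk => absurd hk h
  choose g hg using hex
  exact ⟨g, fun a s hs t ht b hb hlt k hk =>
    hg a k hk s (Finset.mem_powerset.2 hs) t (Finset.mem_powerset.2 ht) ⟨b, hb, hlt⟩⟩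

theorem subset_range_of_lt {s : Finset ℕ} {a : ℕ} (h : ∀ k ∈ s, k ≤ a) :
    s ⊆ Finset.range (a + 1) := fun k hk => Finset.mem_range.2 (Nat.lt_succ_of_le (h k hk))

/-- If the rank of `F` is smaller than the rank of `G`, then `F ⊆ G` on sparse sets. -/
theorem exists_gap_forall_mem {F G : Set (Finset ℕ)} (hF : IsInitClosed F)
    {R : Finset ℕ → Ordinal.{0}} (hR : DecreasesOn F R) {b : Ordinal.{0}} (hG : RankGE G b ∅)
    (hb : R ∅ < b) : ∃ (g : ℕ → ℕ) (L : ℕ), ∀ N : Set ℕ, IsSparse g N → (∀ k ∈ N, L ≤ k) →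
      ∀ u : Finset ℕ, ↑u ⊆ N → u ∈ F → u ∈ G := by
  obtain ⟨g, hg⟩ := exists_gap R G
  obtain ⟨L, hL⟩ := eventually_atTop.1 (hG.eventually hb)
  refine ⟨g, L, fun N hgN hLN => ?_⟩
  -- The rank kept in `G` after adding `a` is that of `u` before adding `a`. This lead of one step,
  -- available at the start because `R ∅ < b`, makes each new target strictly smaller than the rank
  -- at hand.
  have key : ∀ u : Finset ℕ, ∀ a, (∀ k ∈ u, k < a) → ↑(insert a u) ⊆ N → insert a u ∈ F →
      RankGE G (R u) (insert a u) := by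
    intro u
    induction u using Finset.induction_on_max with
    | empty =>
      intro a _ haN _
      exact hL a (hLN a (haN (by simp)))
    | insert c v hc ih =>
      intro a ha haN haF
      have hvF := hF _ a ha haF
      rw [Finset.coe_insert, Set.insert_subset_iff] at haN
      have hca := ha c (Finset.mem_insert_self _ _)
      have hsub : insert c v ⊆ Finset.range (c + 1) := subset_range_of_lt fun k hk => by
        rcases Finset.mem_insert.1 hk with rfl | hk
        exacts [le_rfl, (hc k hk).le]
      exact hg c _ hsub _ hsub _ (ih c hc haN.2 hvF) (hR v c hc hvF) a
        (hgN c (haN.2 (by simp)) a haN.1 hca)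
  intro u huN huF
  induction u using Finset.induction_on_max with
  | empty => exact hG.mem
  | insert c v hc _ => exact (key v c hc huN huF).mem

/-- If the rank of `F` is at most the rank of `G`, then on sparse sets every member of `F` is, up
to its minimum, a member of `G`. -/
theorem exists_gap_forall_erase_mem {F G : Set (Finset ℕ)} (hF : IsInitClosed F)
    {R : Finset ℕ → Ordinal.{0}} (hR : DecreasesOn F R) (hG : RankGE G (R ∅) ∅) :
    ∃ g : ℕ → ℕ, ∀ N : Set ℕ, IsSparse g N →
      ∀ u : Finset ℕ, ↑u ⊆ N → u ∈ F → ∀ m ∈ u, (∀ k ∈ u, m ≤ k) → u.erase m ∈ G := by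
  obtain ⟨g, hg⟩ := exists_gap R G
  refine ⟨g, fun N hgN => ?_⟩
  -- With equal ranks there is no initial lead; leaving the minimum out on the side of `G` creates
  -- it. The minimum also supplies the threshold for the second point, so no lower bound on `N` is
  -- needed.
  have key : ∀ u : Finset ℕ, ∀ a, (∀ k ∈ u, k < a) → ↑(insert a u) ⊆ N → insert a u ∈ F →
      ∀ m ∈ insert a u, (∀ k ∈ insert a u, m ≤ k) → RankGE G (R u) ((insert a u).erase m) := by
    intro u
    induction u using Finset.induction_on_max with
    | empty =>
      intro a _ _ _ m hm _
      obtain rfl : m = a := by simpa using hm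
      simpa using hG
    | insert c v hc ih =>
      intro a ha haN haF m hm hmin
      have hvF := hF _ a ha haF
      rw [Finset.coe_insert, Set.insert_subset_iff] at haN
      have hca := ha c (Finset.mem_insert_self _ _)
      have hsub : insert c v ⊆ Finset.range (c + 1) := subset_range_of_lt fun k hk => by
        rcases Finset.mem_insert.1 hk with rfl | hk
        exacts [le_rfl, (hc k hk).le]
      have hma : m ≠ a := by
        rintro rfl
        exact absurd (hmin c (by simp)) hca.not_ge
      have hm' : m ∈ insert c v := (Finset.mem_insert.1 hm).resolve_left hma
      rw [Finset.erase_insert_of_ne hma.symm]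
      exact hg c _ hsub _ ((Finset.erase_subset _ _).trans hsub) _
        (ih c hc haN.2 hvF m hm' fun k hk => hmin k (Finset.mem_insert_of_mem hk))
        (hR v c hc hvF) a (hgN c (haN.2 (by simp)) a haN.1 hca)
  intro u huN huF
  induction u using Finset.induction_on_max with
  | empty => simp
  | insert c v hc _ => exact fun m hm hmin => (key v c hc huN huF m hm hmin).mem

/-! ### The product of two families -/

/-- The block of `A` that begins at the point `m` of `t` and ends before the next point of `t`. -/
def blk (A t : Finset ℕ) (m : ℕ) : Finset ℕ :=
  A.filter fun k => m ≤ k ∧ ∀ m' ∈ t, m < m' → k < m'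

theorem mem_blk {A t : Finset ℕ} {m k : ℕ} :
    k ∈ blk A t m ↔ k ∈ A ∧ m ≤ k ∧ ∀ m' ∈ t, m < m' → k < m' := by
  rw [blk, Finset.mem_filter]

/-- The cut points `t ∈ G` decompose `s` into blocks that belong to `F`. -/
structure IsCut (F G : Set (Finset ℕ)) (s t : Finset ℕ) : Prop where
  mem : t ∈ G
  subset : t ⊆ s
  cover : ∀ k ∈ s, ∃ m ∈ t, m ≤ k
  blk_mem : ∀ m ∈ t, blk s t m ∈ F

/-- The unions `s₁ ∪ ⋯ ∪ s_d` of members `s₁ < ⋯ < s_d` of `F` for which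
`{min s₁, …, min s_d} ∈ G`. -/
def tensor (F G : Set (Finset ℕ)) : Set (Finset ℕ) := {s | ∃ t, IsCut F G s t}

theorem blk_insert_of_lt {s t : Finset ℕ} {n m : ℕ} (hn : ∀ k ∈ s, k < n) (hts : t ⊆ s)
    (hm : m ∈ t) : blk (insert n s) (insert n t) m = blk s t m := by
  ext k
  simp only [mem_blk, Finset.mem_insert]
  have hmn := hn m (hts hm)
  constructor
  · rintro ⟨rfl | hk, h1, h2⟩
    · exact absurd (h2 k (.inl rfl) hmn) (lt_irrefl _)
    · exact ⟨hk, h1, fun m' hm' => h2 m' (.inr hm')⟩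
  · rintro ⟨hk, h1, h2⟩
    refine ⟨.inr hk, h1, ?_⟩
    rintro m' (rfl | hm') hlt
    · exact hn k hk
    · exact h2 m' hm' hlt

theorem blk_insert_self {s t : Finset ℕ} {n : ℕ} (hn : ∀ k ∈ s, k < n) (hts : t ⊆ s) :
    blk (insert n s) (insert n t) n = {n} := by
  ext k
  simp only [mem_blk, Finset.mem_insert, Finset.mem_singleton]
  constructor
  · rintro ⟨rfl | hk, h1, _⟩
    · rfl
    · exact absurd h1 (hn k hk).not_ge
  · rintro rfl
    refine ⟨.inl rfl, le_rfl, ?_⟩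
    rintro m' (rfl | hm') hlt
    · exact absurd hlt (lt_irrefl _)
    · exact absurd hlt (hn _ (hts hm')).not_gt

theorem blk_insert_max {s t : Finset ℕ} {n m : ℕ} (hn : ∀ k ∈ s, k < n) (hts : t ⊆ s)
    (hm : m ∈ t) (hmax : ∀ k ∈ t, k ≤ m) : blk (insert n s) t m = insert n (blk s t m) := by
  ext k
  simp only [mem_blk, Finset.mem_insert]
  have hmn := hn m (hts hm)
  constructor
  · rintro ⟨rfl | hk, h⟩
    · exact .inl rfl
    · exact .inr ⟨hk, h⟩
  · rintro (rfl | ⟨hk, h⟩)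
    · exact ⟨.inl rfl, hmn.le, fun m' hm' hlt => absurd hlt (hmax m' hm').not_gt⟩
    · exact ⟨.inr hk, h⟩

theorem blk_insert_of_not_max {s t : Finset ℕ} {n m m' : ℕ} (hn : ∀ k ∈ s, k < n) (hts : t ⊆ s)
    (hm' : m' ∈ t) (hlt : m < m') : blk (insert n s) t m = blk s t m := by
  ext k
  simp only [mem_blk, Finset.mem_insert]
  constructor
  · rintro ⟨rfl | hk, h⟩
    · exact absurd (h.2 m' hm' hlt) (hn _ (hts hm')).not_gt
    · exact ⟨hk, h⟩
  · rintro ⟨hk, h⟩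
    exact ⟨.inr hk, h⟩

theorem IsCut.insert_both {F G : Set (Finset ℕ)} {s t : Finset ℕ} {n : ℕ} (h : IsCut F G s t)
    (hn : ∀ k ∈ s, k < n) (hG : insert n t ∈ G) (hF : {n} ∈ F) :
    IsCut F G (insert n s) (insert n t) where
  mem := hG
  subset := Finset.insert_subset_insert n h.subset
  cover k hk := by
    rcases Finset.mem_insert.1 hk with rfl | hk
    · exact ⟨k, by simp⟩
    · obtain ⟨m, hm, hle⟩ := h.cover k hk
      exact ⟨m, Finset.mem_insert_of_mem hm, hle⟩
  blk_mem m hm := by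
    rcases Finset.mem_insert.1 hm with rfl | hm
    · rwa [blk_insert_self hn h.subset]
    · rw [blk_insert_of_lt hn h.subset hm]
      exact h.blk_mem m hm

theorem IsCut.insert_left {F G : Set (Finset ℕ)} {s t : Finset ℕ} {n m : ℕ} (h : IsCut F G s t)
    (hn : ∀ k ∈ s, k < n) (hm : m ∈ t) (hmax : ∀ k ∈ t, k ≤ m)
    (hF : insert n (blk s t m) ∈ F) : IsCut F G (insert n s) t where
  mem := h.mem
  subset := h.subset.trans (Finset.subset_insert _ _)
  cover k hk := by
    rcases Finset.mem_insert.1 hk with rfl | hk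
    · exact ⟨m, hm, (hn m (h.subset hm)).le⟩
    · exact h.cover k hk
  blk_mem m' hm' := by
    rcases (hmax m' hm').eq_or_lt with rfl | hlt
    · rwa [blk_insert_max hn h.subset hm hmax]
    · rw [blk_insert_of_not_max hn h.subset hm hlt]
      exact h.blk_mem m' hm'

/-- The rank still available at `s` is `ξ * a + d`: `a` is left for opening new blocks, each worth
`ξ`, and `d` for prolonging the last block. The alternative `d = 0` covers the root, which has no
last block. -/
theorem rankGE_tensor_aux {F G : Set (Finset ℕ)} {ξ : Ordinal.{0}} (hF : RankGE F ξ ∅)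
    (hξ : 0 < ξ) {c : Ordinal.{0}} : ∀ {s t : Finset ℕ} {a d : Ordinal.{0}}, IsCut F G s t →
      RankGE G a t → c ≤ ξ * a + d →
      (d = 0 ∨ ∃ m ∈ t, (∀ k ∈ t, k ≤ m) ∧ RankGE F d (blk s t m)) →
      RankGE (tensor F G) c s := by
  induction c using WellFoundedLT.induction with
  | _ c ih =>
    intro s t a d hcut hG hc hd
    refine rankGE_iff.2 ⟨⟨t, hcut⟩, fun b hb => ?_⟩
    by_cases hba : b < ξ * a
    · have hdiv : b / ξ < a := (Ordinal.lt_mul_iff_div_lt hξ.ne').1 hba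
      have hmod : b % ξ < ξ := Ordinal.mod_lt b hξ.ne'
      filter_upwards [hG.eventually hdiv, hF.eventually hmod, eventually_forall_lt s]
        with n h1 h2 h3
      have h4 : ({n} : Finset ℕ) = insert n ∅ := rfl
      rw [← h4] at h2
      refine ih b hb (hcut.insert_both h3 h1.mem h2.mem) h1
        (Ordinal.div_add_mod b ξ).ge (.inr ⟨n, by simp, ?_, ?_⟩)
      · intro k hk
        rcases Finset.mem_insert.1 hk with rfl | hk
        exacts [le_rfl, (h3 k (hcut.subset hk)).le]
      · rwa [blk_insert_self h3 hcut.subset]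
    · rw [not_lt] at hba
      have hbd : b < ξ * a + d := hb.trans_le hc
      rcases hd with rfl | ⟨m, hm, hmax, hrk⟩
      · rw [add_zero] at hbd
        exact absurd hba hbd.not_ge
      · have hsub : b - ξ * a < d := by
          rw [Ordinal.sub_lt_of_le hba]
          exact hbd
        filter_upwards [hrk.eventually hsub, eventually_forall_lt s] with n h1 h3
        refine ih b hb (hcut.insert_left h3 hm hmax h1.mem) hG
          (Ordinal.add_sub_cancel_of_le hba).ge (.inr ⟨m, hm, hmax, ?_⟩)
        rwa [blk_insert_max h3 hcut.subset hm hmax]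

theorem rankGE_tensor {F G : Set (Finset ℕ)} {ξ ζ : Ordinal.{0}} (hF : RankGE F ξ ∅)
    (hξ : 0 < ξ) (hG : RankGE G ζ ∅) : RankGE (tensor F G) (ξ * ζ) ∅ :=
  rankGE_tensor_aux hF hξ (t := ∅) (d := 0)
    ⟨hG.mem, Finset.Subset.refl _, by simp, by simp⟩ hG (by simp) (.inl rfl)

/-- A cut of an end-extension restricts to a cut. -/
theorem IsCut.of_insert {F G : Set (Finset ℕ)} (hF : IsInitClosed F) (hG : IsInitClosed G)
    {s t : Finset ℕ} {n : ℕ} (hn : ∀ k ∈ s, k < n) (h : IsCut F G (insert n s) t) :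
    (∃ t', t = insert n t' ∧ (∀ k ∈ t', k < n) ∧ IsCut F G s t' ∧ {n} ∈ F) ∨
      (∃ m ∈ t, (∀ k ∈ t, k ≤ m) ∧ IsCut F G s t ∧ insert n (blk s t m) ∈ F) := by
  by_cases hnt : n ∈ t
  · left
    have hts : t.erase n ⊆ s := fun k hk => by
      rw [Finset.mem_erase] at hk
      exact (Finset.mem_insert.1 (h.subset hk.2)).resolve_left hk.1
    have ht : t = insert n (t.erase n) := (Finset.insert_erase hnt).symm
    rw [ht] at h
    refine ⟨t.erase n, ht, fun k hk => hn k (hts hk), ⟨?_, hts, fun k hk => ?_, fun m hm => ?_⟩, ?_⟩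
    · exact hG _ n (fun k hk => hn k (hts hk)) h.mem
    · obtain ⟨m, hm, hle⟩ := h.cover k (Finset.mem_insert_of_mem hk)
      rcases Finset.mem_insert.1 hm with rfl | hm
      · exact absurd hle (hn k hk).not_ge
      · exact ⟨m, hm, hle⟩
    · rw [← blk_insert_of_lt hn hts hm]
      exact h.blk_mem m (Finset.mem_insert_of_mem hm)
    · rw [← blk_insert_self hn hts]
      exact h.blk_mem n (Finset.mem_insert_self _ _)
  · right
    have hts : t ⊆ s := fun k hk =>
      (Finset.mem_insert.1 (h.subset hk)).resolve_left (ne_of_mem_of_not_mem hk hnt)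
    obtain ⟨m₀, hm₀, _⟩ := h.cover n (Finset.mem_insert_self _ _)
    have hne : t.Nonempty := ⟨m₀, hm₀⟩
    have hm := t.max'_mem hne
    have hmax : ∀ k ∈ t, k ≤ t.max' hne := fun k hk => t.le_max' k hk
    have hins : insert n (blk s t (t.max' hne)) ∈ F := by
      rw [← blk_insert_max hn hts hm hmax]
      exact h.blk_mem _ hm
    refine ⟨t.max' hne, hm, hmax, ⟨h.mem, hts, fun k hk => h.cover k (by simp [hk]), ?_⟩, hins⟩
    intro m hmt
    rcases (hmax m hmt).eq_or_lt with heq | hlt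
    · rw [heq]
      exact hF _ n (fun k hk => hn k (mem_blk.1 hk).1) hins
    · rw [← blk_insert_of_not_max hn hts hm hlt]
      exact h.blk_mem m hmt

theorem IsInitClosed.tensor {F G : Set (Finset ℕ)} (hF : IsInitClosed F) (hG : IsInitClosed G) :
    IsInitClosed (tensor F G) := by
  rintro s n hn ⟨t, ht⟩
  rcases ht.of_insert hF hG hn with ⟨t', _, _, h, _⟩ | ⟨_, _, _, h, _⟩
  exacts [⟨t', h⟩, ⟨t, h⟩]

-- The value of a cut is `RF ∅ * RG t` plus the rank of its last block. Each cut of an end-extension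
-- comes from a cut of `s` of strictly larger value: either the last block has grown, or a new block
-- has lowered `RG t` and its own rank is below `RF ∅`. A set may have several cuts, but finitely
-- many, so the maximum of their values also decreases strictly.
open Classical in
theorem exists_decreasesOn_tensor {F G : Set (Finset ℕ)} (hF : IsInitClosed F)
    (hG : IsInitClosed G) {RF RG : Finset ℕ → Ordinal.{0}} (hRF : DecreasesOn F RF)
    (hRG : DecreasesOn G RG) :
    ∃ R, DecreasesOn (tensor F G) R ∧ R ∅ ≤ RF ∅ * RG ∅ := by
  let last : Finset ℕ → Finset ℕ → Ordinal.{0} := fun s t =>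
    if t = ∅ then 0 else RF (blk s t (t.sup id))
  have hlast : ∀ s t m, m ∈ t → (∀ k ∈ t, k ≤ m) → last s t = RF (blk s t m) := by
    intro s t m hm hmax
    have h1 : t.sup id = m := le_antisymm (Finset.sup_le hmax) (Finset.le_sup (f := id) hm)
    have h2 : t ≠ ∅ := Finset.ne_empty_of_mem hm
    simp only [last, if_neg h2, h1]
  let val : Finset ℕ → Finset ℕ → Ordinal.{0} := fun s t => RF ∅ * RG t + last s t
  let R : Finset ℕ → Ordinal.{0} := fun s => (s.powerset.filter (IsCut F G s)).sup (val s)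
  have hle : ∀ s t, IsCut F G s t → val s t ≤ R s := fun s t h =>
    Finset.le_sup (f := val s) (Finset.mem_filter.2 ⟨Finset.mem_powerset.2 h.subset, h⟩)
  have hstep : ∀ s n t, (∀ k ∈ s, k < n) → IsCut F G (insert n s) t →
      val (insert n s) t < R s := by
    intro s n t hn ht
    rcases ht.of_insert hF hG hn with ⟨t', rfl, hlt, h, hnF⟩ | ⟨m, hm, hmax, h, hins⟩
    · refine lt_of_lt_of_le ?_ (hle s t' h)
      have h1 : last (insert n s) (insert n t') = RF {n} := by
        rw [hlast _ _ n (by simp), blk_insert_self hn h.subset]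
        intro k hk
        rcases Finset.mem_insert.1 hk with rfl | hk
        exacts [le_rfl, (hlt k hk).le]
      have h2 : RF {n} < RF ∅ := hRF ∅ n (by simp) hnF
      have h3 : RG (insert n t') < RG t' := hRG t' n hlt ht.mem
      calc RF ∅ * RG (insert n t') + last (insert n s) (insert n t')
          < RF ∅ * RG (insert n t') + RF ∅ := by
            rw [h1]
            exact add_lt_add_right h2 _
        _ = RF ∅ * Order.succ (RG (insert n t')) := (Ordinal.mul_succ _ _).symm
        _ ≤ RF ∅ * RG t' := mul_le_mul_right (Order.succ_le_of_lt h3) _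
        _ ≤ val s t' := le_self_add
    · refine lt_of_lt_of_le ?_ (hle s t h)
      have h1 : last (insert n s) t < last s t := by
        rw [hlast _ _ m hm hmax, hlast _ _ m hm hmax, blk_insert_max hn h.subset hm hmax]
        exact hRF _ n (fun k hk => hn k (mem_blk.1 hk).1) hins
      exact add_lt_add_right h1 _
  refine ⟨R, fun s n hn hmem => ?_, ?_⟩
  · obtain ⟨t₀, ht₀⟩ := hmem
    refine (Finset.sup_lt_iff ((zero_le).trans_lt (hstep s n t₀ hn ht₀))).2 fun t ht => ?_
    exact hstep s n t hn (Finset.mem_filter.1 ht).2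
  · refine Finset.sup_le fun t ht => ?_
    obtain rfl : t = ∅ := by simpa using (Finset.mem_filter.1 ht).1
    simp [val, last]

/-! ### Adding a minimum to the members of a family -/

/-- The sets that belong to `F` after the removal of their minimum. -/
def addMin (F : Set (Finset ℕ)) : Set (Finset ℕ) :=
  {s | ∀ m ∈ s, (∀ k ∈ s, m ≤ k) → s.erase m ∈ F}

theorem erase_insert_min {s : Finset ℕ} {n m : ℕ} (hn : ∀ k ∈ s, k < n) (hm : m ∈ s) :
    (insert n s).erase m = insert n (s.erase m) :=
  Finset.erase_insert_of_ne (hn m hm).ne'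

theorem IsInitClosed.addMin {F : Set (Finset ℕ)} (hF : IsInitClosed F) :
    IsInitClosed (addMin F) := by
  intro s n hn h m hm hmin
  refine hF _ n (fun k hk => hn k (Finset.mem_of_mem_erase hk)) ?_
  rw [← erase_insert_min hn hm]
  refine h m (Finset.mem_insert_of_mem hm) fun k hk => ?_
  rcases Finset.mem_insert.1 hk with rfl | hk
  exacts [(hn m hm).le, hmin k hk]

theorem exists_decreasesOn_addMin {F : Set (Finset ℕ)} {R : Finset ℕ → Ordinal.{0}}
    (hR : DecreasesOn F R) :
    ∃ R', DecreasesOn (addMin F) R' ∧ R' ∅ = Order.succ (R ∅) := by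
  -- The free minimum adds exactly one level, at the root.
  let R' : Finset ℕ → Ordinal.{0} := fun s =>
    if h : s.Nonempty then R (s.erase (s.min' h)) else Order.succ (R ∅)
  have hR' : ∀ s m, m ∈ s → (∀ k ∈ s, m ≤ k) → R' s = R (s.erase m) := by
    intro s m hm hmin
    have h : s.Nonempty := ⟨m, hm⟩
    have : s.min' h = m := le_antisymm (s.min'_le m hm) (hmin _ (s.min'_mem h))
    simp only [R', dif_pos h, this]
  have h0 : R' ∅ = Order.succ (R ∅) := dif_neg (by simp)
  refine ⟨R', fun s n hn h => ?_, h0⟩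
  rcases s.eq_empty_or_nonempty with rfl | hne
  · rw [h0, hR' _ n (by simp) (by simp)]
    simp
  · have hm := s.min'_mem hne
    have hmin : ∀ k ∈ s, s.min' hne ≤ k := fun k hk => s.min'_le k hk
    have hmin' : ∀ k ∈ insert n s, s.min' hne ≤ k := fun k hk => by
      rcases Finset.mem_insert.1 hk with rfl | hk
      exacts [(hn _ hm).le, hmin k hk]
    rw [hR' _ _ hm hmin, hR' _ _ (Finset.mem_insert_of_mem hm) hmin', erase_insert_min hn hm]
    refine hR _ n (fun k hk => hn k (Finset.mem_of_mem_erase hk)) ?_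
    rw [← erase_insert_min hn hm]
    exact h _ (Finset.mem_insert_of_mem hm) hmin'

/-! ### The family of the end-extensions of a node -/

/-- The sets that extend `s` to a member of `F`. -/
def extensions (F : Set (Finset ℕ)) (s : Finset ℕ) : Set (Finset ℕ) :=
  {t | (∀ j ∈ s, ∀ k ∈ t, j < k) ∧ s ∪ t ∈ F}

theorem union_lt {s t : Finset ℕ} {n : ℕ} (ht : ∀ k ∈ t, k < n)
    (hs : ∀ j ∈ s, ∀ k ∈ insert n t, j < k) : ∀ k ∈ s ∪ t, k < n := fun k hk => by
  rcases Finset.mem_union.1 hk with hk | hk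
  exacts [hs k hk n (Finset.mem_insert_self _ _), ht k hk]

theorem IsInitClosed.extensions {F : Set (Finset ℕ)} (hF : IsInitClosed F) (s : Finset ℕ) :
    IsInitClosed (extensions F s) := fun t n hn h =>
  ⟨fun j hj k hk => h.1 j hj k (Finset.mem_insert_of_mem hk), hF _ n (union_lt hn h.1) (by
    rw [← Finset.union_insert]
    exact h.2)⟩

theorem DecreasesOn.extensions {F : Set (Finset ℕ)} {R : Finset ℕ → Ordinal.{0}}
    (hR : DecreasesOn F R) (s : Finset ℕ) :
    DecreasesOn (extensions F s) fun t => R (s ∪ t) := fun t n hn h => by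
  have := h.2
  rw [Finset.union_insert] at this
  simp only [Finset.union_insert]
  exact hR _ n (union_lt hn h.1) this

/-- With `DecreasesOn.extensions`, this shows that the subtree above a node has exactly the rank of
the node, so a family of prescribed rank can be found inside a given one. -/
theorem RankGE.extensions {F : Set (Finset ℕ)} {s : Finset ℕ} {a : Ordinal.{0}} :
    ∀ {t : Finset ℕ}, (∀ j ∈ s, ∀ k ∈ t, j < k) → RankGE F a (s ∪ t) →
      RankGE (extensions F s) a t := by
  induction a using WellFoundedLT.induction with
  | _ a ih =>
    intro t hst h
    refine rankGE_iff.2 ⟨⟨hst, h.mem⟩, fun b hb => ?_⟩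
    filter_upwards [h.eventually hb, eventually_forall_lt s] with n h1 h2
    refine ih b hb (fun j hj k hk => ?_) (by rwa [Finset.union_insert])
    rcases Finset.mem_insert.1 hk with rfl | hk
    exacts [h2 j hj, hst j hj k hk]

/-! ### Estimates for the norms -/

theorem Interpolates.sum_apply {t : Finset ℕ} {g : ℕ → ℕ →₀ ℝ}
    (h : Interpolates t fun m => (g m).support) {m k : ℕ} (hm : m ∈ t) (hk : k ∈ (g m).support) :
    (∑ j ∈ t, g j) k = g m k := by
  rw [Finsupp.finsetSum_apply]
  refine Finset.sum_eq_single_of_mem m hm fun j hj hne => ?_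
  by_contra hjk
  exact hne (h.unique hj hm (Finsupp.mem_support_iff.2 hjk) hk)

theorem Interpolates.mem_support_iff {θ : ℝ} (hθ : θ ≠ 0) {t : Finset ℕ} {g : ℕ → ℕ →₀ ℝ}
    (h : Interpolates t fun m => (g m).support) {k : ℕ} :
    k ∈ (θ • ∑ m ∈ t, g m).support ↔ ∃ m ∈ t, k ∈ (g m).support := by
  rw [Finsupp.mem_support_iff, Finsupp.smul_apply, smul_eq_mul, mul_ne_zero_iff]
  constructor
  · rintro ⟨-, hk⟩
    rw [Finsupp.finsetSum_apply] at hk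
    obtain ⟨m, hm, hmk⟩ := Finset.exists_ne_zero_of_sum_ne_zero hk
    exact ⟨m, hm, Finsupp.mem_support_iff.2 hmk⟩
  · rintro ⟨m, hm, hk⟩
    rw [h.sum_apply hm hk]
    exact ⟨hθ, Finsupp.mem_support_iff.1 hk⟩

/-- For spreading `F`, an admissible sequence is interpolated by the set of its minima. -/
@[elab_as_elim]
theorem NormingSet.induction_min {F : Set (Finset ℕ)} {θ : ℝ} (hF : IsSpreading F)
    {P : (ℕ →₀ ℝ) → Prop} (pos : ∀ n, P (Finsupp.single n 1))
    (neg : ∀ n, P (Finsupp.single n (-1)))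
    (op : ∀ t ∈ F, ∀ g : ℕ → ℕ →₀ ℝ, (∀ m ∈ t, P (g m)) → (∀ m ∈ t, m ∈ (g m).support) →
      Interpolates t (fun m => (g m).support) → P (θ • ∑ m ∈ t, g m))
    {f : ℕ →₀ ℝ} (hf : NormingSet F θ f) : P f := by
  induction hf with
  | pos n => exact pos n
  | neg n => exact neg n
  | op t ht g hg hadm ih =>
    have hex : ∀ m, ∃ k, m ∈ t → k ∈ (g m).support ∧ ∀ l ∈ (g m).support, k ≤ l := by
      intro m
      by_cases hm : m ∈ t
      · have h := (hadm m hm).1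
        exact ⟨_, fun _ => ⟨Finset.min'_mem _ h, fun l hl => Finset.min'_le _ l hl⟩⟩
      · exact ⟨0, fun h => absurd h hm⟩
    choose φ hφ using hex
    have hle : ∀ m ∈ t, m ≤ φ m := fun m hm => ((hadm m hm).2 _ (hφ m hm).1).1
    have hlt : ∀ a ∈ t, ∀ b ∈ t, a < b → φ a < b := fun a ha b hb hab =>
      ((hadm a ha).2 _ (hφ a ha).1).2 b hb hab
    have hmono : StrictMonoOn φ t := fun a ha b hb hab => (hlt a ha b hb hab).trans_le (hle b hb)
    let ψ := Function.invFunOn φ t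
    have hψ : ∀ m ∈ t, ψ (φ m) = m := fun m hm =>
      hmono.injOn (Function.invFunOn_mem ⟨m, hm, rfl⟩) hm (Function.invFunOn_eq ⟨m, hm, rfl⟩)
    have hsum : ∑ m ∈ t, g m = ∑ k ∈ t.image φ, g (ψ k) := by
      rw [Finset.sum_image hmono.injOn]
      exact Finset.sum_congr rfl fun m hm => by rw [hψ m hm]
    rw [hsum]
    -- Each interpolating point moves up to the minimum of its block. Afterwards the interpolating
    -- set lies in the support, hence in `N`, where families can be compared.
    refine op _ (hF t ht _ (SpreadLE.of_map hmono hle)) (fun k => g (ψ k)) ?_ ?_ ?_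
    · intro k hk
      obtain ⟨m, hm, rfl⟩ := Finset.mem_image.1 hk
      rw [hψ m hm]
      exact ih m hm
    · intro k hk
      obtain ⟨m, hm, rfl⟩ := Finset.mem_image.1 hk
      rw [hψ m hm]
      exact (hφ m hm).1
    · intro k hk
      obtain ⟨m, hm, rfl⟩ := Finset.mem_image.1 hk
      simp only [hψ m hm]
      refine ⟨(hadm m hm).1, fun l hl => ⟨(hφ m hm).2 l hl, fun k' hk' hlt' => ?_⟩⟩
      obtain ⟨m', hm', rfl⟩ := Finset.mem_image.1 hk'
      exact (((hadm m hm).2 l hl).2 m' hm' ((hmono.lt_iff_lt hm hm').1 hlt')).trans_le (hle m' hm')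

theorem restrict_restrict_of_subset {E E' : Finset ℕ} (h : E ⊆ E') (x : ℕ →₀ ℝ) :
    restrict E (restrict E' x) = restrict E x := by
  ext n
  simp only [restrict_apply]
  by_cases hn : n ∈ E
  · simp [hn, h hn]
  · simp [hn]

theorem restrict_support_self (x : ℕ →₀ ℝ) : restrict x.support x = x := by
  ext n
  rw [restrict_apply]
  split_ifs with h
  · rfl
  · exact (Finsupp.notMem_support_iff.1 h).symm

section Norm

variable {F : Set (Finset ℕ)} {θ : ℝ}

theorem tNorm_restrict_le (h0 : 0 < θ) (h1 : θ < 1) (hF : IsHereditary F) (E : Finset ℕ)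
    (x : ℕ →₀ ℝ) : tNorm F θ (restrict E x) ≤ tNorm F θ x :=
  tNorm_le fun f hf => by
    rw [pair_restrict]
    rcases hf.restrict_mem hF E with h | h
    · rw [h]
      simpa [pair] using tNorm_nonneg (F := F) h0 h1 x
    · exact pair_le_tNorm h0 h1 h x

theorem tNorm_restrict_mono (h0 : 0 < θ) (h1 : θ < 1) (hF : IsHereditary F) {E E' : Finset ℕ}
    (h : E ⊆ E') (x : ℕ →₀ ℝ) : tNorm F θ (restrict E x) ≤ tNorm F θ (restrict E' x) := by
  rw [← restrict_restrict_of_subset h]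
  exact tNorm_restrict_le h0 h1 hF _ _

/-- A bound for the functionals supported by `N` bounds the norm of the vectors supported by
`N`. -/
theorem tNorm_le_of_support_subset (hF : IsHereditary F) {N : Set ℕ} {x : ℕ →₀ ℝ}
    (hx : ↑x.support ⊆ N) {r : ℝ} (hr : 0 ≤ r)
    (h : ∀ f, NormingSet F θ f → ↑f.support ⊆ N → pair f x ≤ r) : tNorm F θ x ≤ r :=
  tNorm_le fun f hf => by
    rw [← restrict_support_self x, pair_restrict]
    rcases hf.restrict_mem hF x.support with h' | h'
    · rw [h']
      simpa [pair] using hr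
    · exact h _ h' fun k hk => hx (support_restrict _ _ hk)

end Norm

/-- Inclusion of the families on `N` gives domination of the norms on `N`. -/
theorem tNorm_le_of_forall_mem {F G : Set (Finset ℕ)} {θ : ℝ} (h0 : 0 < θ) (h1 : θ < 1)
    (hF : IsHereditary F) (hFs : IsSpreading F) {N : Set ℕ}
    (h : ∀ u : Finset ℕ, ↑u ⊆ N → u ∈ F → u ∈ G) {x : ℕ →₀ ℝ} (hx : ↑x.support ⊆ N) :
    tNorm F θ x ≤ tNorm G θ x := by
  have key : ∀ f, NormingSet F θ f → ↑f.support ⊆ N → NormingSet G θ f := by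
    intro f hf
    refine NormingSet.induction_min hFs (fun n _ => .pos n) (fun n _ => .neg n) ?_ hf
    · intro t ht g ih hmin hadm hsub
      have hs : ∀ m ∈ t, ∀ k ∈ (g m).support, k ∈ N := fun m hm k hk =>
        hsub ((hadm.mem_support_iff h0.ne').2 ⟨m, hm, hk⟩)
      exact .op t (h t (fun m hm => hs m hm m (hmin m hm)) ht) g
        (fun m hm => ih m hm (hs m hm)) hadm
  exact tNorm_le_of_support_subset hF hx (tNorm_nonneg h0 h1 x) fun f hf hs =>
    pair_le_tNorm h0 h1 (key f hf hs) x

/-! ### Regrouping the blocks of a functional -/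

theorem sum_blk {s t : Finset ℕ} (hcov : ∀ k ∈ s, ∃ m ∈ t, m ≤ k) (w : ℕ → ℝ) :
    ∑ m ∈ t, ∑ k ∈ blk s t m, w k = ∑ k ∈ s, w k := by
  rw [← Finset.sum_biUnion]
  · refine Finset.sum_congr ?_ fun _ _ => rfl
    ext k
    rw [Finset.mem_biUnion]
    refine ⟨fun ⟨m, _, hk⟩ => (mem_blk.1 hk).1, fun hk => ?_⟩
    obtain ⟨m, hm, hmk⟩ := hcov k hk
    have hne : (t.filter (· ≤ k)).Nonempty := ⟨m, Finset.mem_filter.2 ⟨hm, hmk⟩⟩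
    have hmax := Finset.mem_filter.1 (Finset.max'_mem _ hne)
    refine ⟨_, hmax.1, mem_blk.2 ⟨hk, hmax.2, fun m' hm' hlt => ?_⟩⟩
    by_contra! hle
    exact (Finset.le_max' _ m' (Finset.mem_filter.2 ⟨hm', hle⟩)).not_gt hlt
  · intro m hm m' hm' hne
    rw [Function.onFun, Finset.disjoint_left]
    intro k hk hk'
    obtain ⟨_, h1, h2⟩ := mem_blk.1 hk
    obtain ⟨_, h3, h4⟩ := mem_blk.1 hk'
    rcases hne.lt_or_gt with hlt | hlt
    · exact (h2 m' hm' hlt).not_ge h3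
    · exact (h4 m hm hlt).not_ge h1

theorem pair_le_sum_of_single {F C : Set (Finset ℕ)} {θ : ℝ} (h0 : 0 < θ) (h1 : θ < 1)
    (hC : ∅ ∈ C) (n : ℕ) {c : ℝ} (hc : |c| = 1) :
    ∃ t ⊆ (Finsupp.single n c).support, t ∈ addMin C ∧
      (∀ k ∈ (Finsupp.single n c).support, ∃ m ∈ t, m ≤ k) ∧ ∀ x, pair (Finsupp.single n c) x ≤
        ∑ m ∈ t, tNorm F θ (restrict (blk (Finsupp.single n c).support t m) x) := by
  have hs : (Finsupp.single n c).support = {n} :=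
    Finsupp.support_single n (b := c) fun h => by simp [h] at hc
  rw [hs]
  refine ⟨{n}, Finset.Subset.refl _, ?_, fun k hk => ⟨k, hk, le_rfl⟩, fun x => ?_⟩
  · intro m hm _
    rw [Finset.mem_singleton.1 hm]
    simpa using hC
  · have hblk : n ∈ blk {n} {n} n := mem_blk.2 ⟨by simp, le_rfl, by simp⟩
    rw [pair_single, Finset.sum_singleton]
    refine le_trans ?_ (abs_apply_le_tNorm h0 h1 _ n)
    rw [restrict_apply, if_pos hblk]
    refine (le_abs_self _).trans ?_
    rw [abs_mul, hc, one_mul]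

/-- The functionals of `K(F, θ)` that are supported by `N` are, up to their first block, sums of
`C`-admissible sequences of functionals of `K(G, θ)`, as soon as `addMin C ⊗ F` is contained in
`G ⊗ C` on `N`, up to the minima. -/
theorem exists_pair_le_sum {F G C : Set (Finset ℕ)} {θ : ℝ} (h0 : 0 < θ) (h1 : θ < 1)
    (hF : IsSpreading F) (hG : IsHereditary G) (hC : ∅ ∈ C) {N : Set ℕ}
    (hN : ∀ u : Finset ℕ, ↑u ⊆ N → u ∈ tensor (addMin C) F → ∀ m ∈ u, (∀ k ∈ u, m ≤ k) →
      u.erase m ∈ tensor G C) {f : ℕ →₀ ℝ} (hf : NormingSet F θ f) :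
    ↑f.support ⊆ N → ∃ t ⊆ f.support, t ∈ addMin C ∧ (∀ k ∈ f.support, ∃ m ∈ t, m ≤ k) ∧
      ∀ x, pair f x ≤ ∑ m ∈ t, tNorm G θ (restrict (blk f.support t m) x) := by
  refine NormingSet.induction_min hF
    (fun n _ => pair_le_sum_of_single h0 h1 hC n (by simp))
    (fun n _ => pair_le_sum_of_single h0 h1 hC n (by simp)) ?_ hf
  · clear hf f
    intro τ hτ g ih hmin hadm
    have hsupp := fun k => hadm.mem_support_iff h0.ne' (k := k)
    set f := θ • ∑ m ∈ τ, g m with hf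
    intro hfN
    rcases τ.eq_empty_or_nonempty with rfl | ⟨j₀, hj₀⟩
    · have hz : f = 0 := by simp [hf]
      refine ⟨∅, Finset.empty_subset _, by simp [addMin], by simp [hz], by simp [hz, pair]⟩
    have hex : ∀ j, ∃ T : Finset ℕ, j ∈ τ → T ⊆ (g j).support ∧ T ∈ addMin C ∧
        (∀ k ∈ (g j).support, ∃ m ∈ T, m ≤ k) ∧
        ∀ x, pair (g j) x ≤ ∑ m ∈ T, tNorm G θ (restrict (blk (g j).support T m) x) := by
      intro j
      by_cases hj : j ∈ τ
      · obtain ⟨T, hT⟩ := ih j hj fun k hk => hfN ((hsupp k).2 ⟨j, hj, hk⟩)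
        exact ⟨T, fun _ => hT⟩
      · exact ⟨∅, fun h => absurd h hj⟩
    choose T hT using hex
    have hle : ∀ j ∈ τ, ∀ k ∈ (g j).support, j ≤ k := fun j hj k hk => ((hadm j hj).2 k hk).1
    have hlt : ∀ j ∈ τ, ∀ k ∈ (g j).support, ∀ i ∈ τ, j < i → k < i := fun j hj k hk =>
      ((hadm j hj).2 k hk).2
    -- `j` is the least point of the support of `g j`, and `T j` must have a point at or below it.
    have hjT : ∀ j ∈ τ, j ∈ T j := fun j hj => by
      obtain ⟨m, hm, hmj⟩ := (hT j hj).2.2.1 j (hmin j hj)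
      rwa [hmj.antisymm (hle j hj m ((hT j hj).1 hm))] at hm
    let S := τ.biUnion T
    have hmemS : ∀ k, k ∈ S ↔ ∃ j ∈ τ, k ∈ T j := fun k => Finset.mem_biUnion
    have hSf : S ⊆ f.support := fun k hk => by
      obtain ⟨j, hj, hkj⟩ := (hmemS k).1 hk
      exact (hsupp k).2 ⟨j, hj, (hT j hj).1 hkj⟩
    have hblk : ∀ j ∈ τ, blk S τ j = T j := by
      intro j hj
      ext k
      rw [mem_blk, hmemS]
      constructor
      · rintro ⟨⟨i, hi, hki⟩, hjk, hnext⟩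
        have hki' := (hT i hi).1 hki
        rcases lt_trichotomy i j with h | rfl | h
        · exact absurd (hlt i hi k hki' j hj h) hjk.not_gt
        · exact hki
        · exact absurd (hnext i hi h) (hle i hi k hki').not_gt
      · intro hk
        have hk' := (hT j hj).1 hk
        exact ⟨⟨j, hj, hk⟩, hle j hj k hk', hlt j hj k hk'⟩
    have hcov : ∀ k ∈ S, ∃ m ∈ τ, m ≤ k := fun k hk => by
      obtain ⟨j, hj, hkj⟩ := (hmemS k).1 hk
      exact ⟨j, hj, hle j hj k ((hT j hj).1 hkj)⟩
    -- `τ` is the cut: its blocks in `S` are exactly the sets `T j`.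
    have hSmem : S ∈ tensor (addMin C) F := by
      refine ⟨τ, hτ, fun j hj => (hmemS j).2 ⟨j, hj, hjT j hj⟩, hcov, fun j hj => ?_⟩
      rw [hblk j hj]
      exact (hT j hj).2.1
    have hSne : S.Nonempty := ⟨j₀, (hmemS _).2 ⟨j₀, hj₀, hjT j₀ hj₀⟩⟩
    obtain ⟨m₀, hm₀, hm₀min⟩ : ∃ m ∈ S, ∀ k ∈ S, m ≤ k :=
      ⟨_, S.min'_mem hSne, fun k hk => S.min'_le k hk⟩
    -- The order of the product is exchanged: `S` without its minimum is now a `C`-admissible union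
    -- of members of `G`, with cut points `D`. Restoring the minimum gives `t`, a member of `addMin
    -- C`, so the induction closes with the same outer family.
    obtain ⟨D, hD⟩ := hN S (fun k hk => hfN (hSf hk)) hSmem m₀ hm₀ hm₀min
    have hDS : D ⊆ S := hD.subset.trans (Finset.erase_subset _ _)
    have hm₀D : m₀ ∉ D := fun h => Finset.notMem_erase m₀ S (hD.subset h)
    let t := insert m₀ D
    have htS : t ⊆ S := Finset.insert_subset hm₀ hDS
    have hnonneg : ∀ x, 0 ≤ tNorm G θ x := tNorm_nonneg h0 h1
    refine ⟨t, htS.trans hSf, ?_, ?_, fun x => ?_⟩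
    · intro m hm hm'
      rw [(hm' m₀ (Finset.mem_insert_self _ _)).antisymm (hm₀min m (htS hm)),
        Finset.erase_insert hm₀D]
      exact hD.mem
    · intro k hk
      obtain ⟨j, hj, hkj⟩ := (hsupp k).1 hk
      exact ⟨m₀, Finset.mem_insert_self _ _,
        (hm₀min j ((hmemS _).2 ⟨j, hj, hjT j hj⟩)).trans (hle j hj k hkj)⟩
    · let w : ℕ → ℝ := fun k => tNorm G θ (restrict (blk f.support S k) x)
      -- A piece of `g j` that starts at `k` ends before the next point of `S`: that point is in `T
      -- j`, or lies in a later `T i` and so beyond the support of `g j`.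
      have hsum : ∑ j ∈ τ, pair (g j) x ≤ ∑ k ∈ S, w k := by
        rw [← sum_blk hcov]
        refine Finset.sum_le_sum fun j hj => ?_
        rw [hblk j hj]
        refine ((hT j hj).2.2.2 x).trans (Finset.sum_le_sum fun k hk => ?_)
        refine tNorm_restrict_mono h0 h1 hG (fun l hl => ?_) x
        obtain ⟨hl1, hl2, hl3⟩ := mem_blk.1 hl
        refine mem_blk.2 ⟨(hsupp l).2 ⟨j, hj, hl1⟩, hl2, fun m' hm' hkm' => ?_⟩
        obtain ⟨i, hi, hmi⟩ := (hmemS m').1 hm'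
        have hmi' := (hT i hi).1 hmi
        rcases lt_trichotomy i j with h | rfl | h
        · have h3 := hlt i hi m' hmi' j hj h
          have h4 := hle j hj k ((hT j hj).1 hk)
          omega
        · exact hl3 m' hmi hkm'
        · exact (hlt j hj l hl1 i hi h).trans_le (hle i hi m' hmi')
      -- The pieces that start in one block of `D` form a `G`-admissible sequence inside the larger
      -- piece of `t` from `m`; the implicit inequality for `G` absorbs `θ`.
      have hblkD : ∀ m ∈ D, θ * ∑ k ∈ blk (S.erase m₀) D m, w k ≤
          tNorm G θ (restrict (blk f.support t m) x) := by
        intro m hm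
        have hsub : ∀ k ∈ blk (S.erase m₀) D m, blk f.support S k ⊆ blk f.support t m := by
          intro k hk l hl
          obtain ⟨-, hk2, hk3⟩ := mem_blk.1 hk
          obtain ⟨hl1, hl2, hl3⟩ := mem_blk.1 hl
          refine mem_blk.2 ⟨hl1, hk2.trans hl2, fun m' hm' hlt' => hl3 m' (htS hm') ?_⟩
          rcases Finset.mem_insert.1 hm' with rfl | hm'
          · exact absurd (hm₀min m (hDS hm)) hlt'.not_ge
          · exact hk3 m' hm' hlt'
        have hadm' : Interpolates (blk (S.erase m₀) D m) (blk f.support S) := by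
          intro k hk
          have hkS := Finset.mem_of_mem_erase (mem_blk.1 hk).1
          refine ⟨⟨k, mem_blk.2 ⟨hSf hkS, le_rfl, fun _ _ h => h⟩⟩, fun l hl => ?_⟩
          obtain ⟨-, hl2, hl3⟩ := mem_blk.1 hl
          exact ⟨hl2, fun m' hm' =>
            hl3 m' (Finset.mem_of_mem_erase (mem_blk.1 hm').1)⟩
        have h := mul_sum_tNorm_le h0 h1 hG (hD.blk_mem m hm) hadm'
          (restrict (blk f.support t m) x)
        refine le_trans (le_of_eq ?_) h
        congr 1
        exact Finset.sum_congr rfl fun k hk => by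
          rw [restrict_restrict_of_subset (hsub k hk)]
      -- The exceptional first piece is in no group; its factor `θ < 1` is simply dropped.
      have hfirst : θ * w m₀ ≤ tNorm G θ (restrict (blk f.support t m₀) x) := by
        refine (mul_le_of_le_one_left (hnonneg _) h1.le).trans ?_
        refine tNorm_restrict_mono h0 h1 hG (fun l hl => ?_) x
        obtain ⟨hl1, hl2, hl3⟩ := mem_blk.1 hl
        exact mem_blk.2 ⟨hl1, hl2, fun m' hm' => hl3 m' (htS hm')⟩
      calc pair f x = θ * ∑ j ∈ τ, pair (g j) x := pair_op θ τ g x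
        _ ≤ θ * ∑ k ∈ S, w k := by gcongr
        _ = θ * w m₀ + ∑ m ∈ D, θ * ∑ k ∈ blk (S.erase m₀) D m, w k := by
          rw [← Finset.add_sum_erase S w hm₀, ← sum_blk hD.cover, mul_add, Finset.mul_sum]
        _ ≤ tNorm G θ (restrict (blk f.support t m₀) x) +
            ∑ m ∈ D, tNorm G θ (restrict (blk f.support t m) x) :=
          add_le_add hfirst (Finset.sum_le_sum hblkD)
        _ = ∑ m ∈ t, tNorm G θ (restrict (blk f.support t m) x) :=
          (Finset.sum_insert (f := fun m => tNorm G θ (restrict (blk f.support t m) x)) hm₀D).symm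

/-- If moreover `C ⊆ G` on `N`, then `‖·‖_{(F, θ)} ≤ (1 + θ⁻¹) ‖·‖_{(G, θ)}` on `N`. -/
theorem tNorm_le_mul_tNorm {F G C : Set (Finset ℕ)} {θ : ℝ} (h0 : 0 < θ) (h1 : θ < 1)
    (hF : IsHereditary F) (hFs : IsSpreading F) (hG : IsHereditary G) (hC : ∅ ∈ C) {N : Set ℕ}
    (hN : ∀ u : Finset ℕ, ↑u ⊆ N → u ∈ tensor (addMin C) F → ∀ m ∈ u, (∀ k ∈ u, m ≤ k) →
      u.erase m ∈ tensor G C)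
    (hCG : ∀ u : Finset ℕ, ↑u ⊆ N → u ∈ C → u ∈ G) {x : ℕ →₀ ℝ} (hx : ↑x.support ⊆ N) :
    tNorm F θ x ≤ (1 + θ⁻¹) * tNorm G θ x := by
  have hnn := tNorm_nonneg (F := G) h0 h1 x
  refine tNorm_le_of_support_subset hF hx (by positivity) fun f hf hfN => ?_
  obtain ⟨t, htf, htC, -, hle⟩ := exists_pair_le_sum h0 h1 hFs hG hC hN hf hfN
  refine (hle x).trans ?_
  rcases t.eq_empty_or_nonempty with rfl | hne
  · rw [Finset.sum_empty]
    positivity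
  · have hm := t.min'_mem hne
    have hmem := htC _ hm fun k hk => t.min'_le k hk
    rw [← Finset.add_sum_erase t _ hm, add_mul, one_mul]
    refine add_le_add (tNorm_restrict_le h0 h1 hG _ _) ?_
    rw [← div_eq_inv_mul, le_div_iff₀' h0]
    refine mul_sum_tNorm_le h0 h1 hG
      (hCG _ (fun k hk => hfN (htf (Finset.mem_of_mem_erase hk))) hmem) (fun m hm => ?_) x
    have hmt := Finset.mem_of_mem_erase hm
    refine ⟨⟨m, mem_blk.2 ⟨htf hmt, le_rfl, fun _ _ h => h⟩⟩, fun k hk => ?_⟩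
    obtain ⟨-, hk2, hk3⟩ := mem_blk.1 hk
    exact ⟨hk2, fun m' hm' => hk3 m' (Finset.mem_of_mem_erase hm')⟩

/-! ### Passage to the spaces, ordinal arithmetic and conclusion -/

theorem norm_sum_basisVec_subtype (F : Set (Finset ℕ)) (θ : Set.Ioo (0 : ℝ) 1) {N : Set ℕ}
    (a : N →₀ ℝ) : ‖a.sum fun i c => c • basisVec F θ i‖ =
      tNorm F (θ : ℝ) (a.mapDomain (Subtype.val : N → ℕ)) := by
  rw [← norm_sum_basisVec, Finsupp.sum_mapDomain_index (by simp)
    (by intros; rw [add_smul])]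

/-- The extra 1 contributed by the free minimum is absorbed: `ω ^ b + 1 ≤ ω ^ b * 2`, and `2 * ω ^ c
= ω ^ c` for `c > 0`. -/
theorem succ_opow_mul_opow_le {b c : Ordinal.{0}} (hc : 0 < c) :
    Order.succ (ω ^ b) * ω ^ c ≤ ω ^ (b + c) := by
  have hpos : (0 : Ordinal) < ω ^ b := Ordinal.opow_pos _ Ordinal.omega0_pos
  have h1 : Order.succ (ω ^ b) ≤ ω ^ b * 2 := by
    rw [← one_add_one_eq_two, mul_add, mul_one, Order.succ_eq_add_one]
    exact add_le_add_right (Order.one_le_iff_pos.2 hpos) _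
  have h2 : (2 : Ordinal) * ω ^ c = ω ^ c :=
    Ordinal.mul_omega0_dvd (by simp) (Ordinal.natCast_lt_omega0 2) (by
      simpa using Ordinal.opow_dvd_opow ω (Order.one_le_iff_pos.2 hc))
  calc Order.succ (ω ^ b) * ω ^ c ≤ ω ^ b * 2 * ω ^ c := mul_le_mul_left h1 _
    _ = ω ^ (b + c) := by rw [mul_assoc, h2, Ordinal.opow_add]

end

end Tsirelson

open Tsirelson in
theorem mainTheorem7 (B₀ B₁ : Set (Finset ℕ))
    (hB₀ : Tsirelson.IsRegular B₀) (hB₁ : Tsirelson.IsRegular B₁)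
    (α β lam : Ordinal.{0}) (hβ : 0 < β) (hβlam : β < ω ^ lam) (hlam : ω ^ lam ≤ α) (hα : ω ≤ α)
    (hι₀ : Tsirelson.cbIndex B₀ = ω ^ (α + β)) (hι₁ : Tsirelson.cbIndex B₁ = ω ^ α)
    (θ : Set.Ioo (0 : ℝ) 1) (M : Set ℕ) (hM : M.Infinite) :
    ∃ N ⊆ M, N.Infinite ∧
      Tsirelson.EquivalentSeq (fun n : N => Tsirelson.basisVec B₀ θ n)
        (fun n : N => Tsirelson.basisVec B₁ θ n) := by
  have hpos : ∀ a : Ordinal.{0}, 0 < ω ^ a := fun a => Ordinal.opow_pos a Ordinal.omega0_pos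
  have hβα : β + α = α := Ordinal.add_of_omega0_opow_le hβlam hlam
  have hlt₁ : (ω ^ β : Ordinal.{0}) < ω ^ α :=
    (Ordinal.opow_lt_opow_iff_right Ordinal.one_lt_omega0).2 (hβlam.trans_le hlam)
  have hlt₀ : (ω ^ α : Ordinal.{0}) < ω ^ (α + β) :=
    (Ordinal.opow_lt_opow_iff_right Ordinal.one_lt_omega0).2 (lt_add_of_pos_right α hβ)
  obtain ⟨R₀, hR₀, hR₀e, hiff₀⟩ := exists_rank hB₀.hereditary hB₀.spreading (hι₀ ▸ hpos _)
  obtain ⟨R₁, hR₁, hR₁e, hiff₁⟩ := exists_rank hB₁.hereditary hB₁.spreading (hι₁ ▸ hpos _)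
  have hrk₀ := rankGE_cbIndex hB₀.hereditary hB₀.spreading (hι₀ ▸ hpos _)
  have hrk₁ := rankGE_cbIndex hB₁.hereditary hB₁.spreading (hι₁ ▸ hpos _)
  rw [hι₀] at hR₀e hrk₀
  rw [hι₁] at hR₁e hrk₁
  have hi₀ := hB₀.hereditary.isInitClosed
  have hi₁ := hB₁.hereditary.isInitClosed
  -- The auxiliary family `C` of rank `ω ^ β` is the subtree of `B₀` above a node of that rank.
  obtain ⟨s, hsB, hs⟩ := exists_rank_eq hR₀ hiff₀ hrk₀.mem (hR₀e ▸ (hlt₁.trans hlt₀).le)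
  have hrkC : RankGE (extensions B₀ s) (ω ^ β) ∅ :=
    RankGE.extensions (by simp) ((hiff₀ _ _).2 (by simp [hsB, hs]))
  have hRC := hR₀.extensions s
  have hRCe : R₀ (s ∪ ∅) = ω ^ β := by rw [Finset.union_empty, hs]
  have hiC := hi₀.extensions s
  generalize extensions B₀ s = C at hrkC hRC hiC
  obtain ⟨R', hR', hR'e⟩ := exists_decreasesOn_addMin hRC
  obtain ⟨R, hR, hRe⟩ := exists_decreasesOn_tensor hiC.addMin hi₀ hR' hR₀
  -- The decisive use of `β + α = α`: the exponent `β + (α + β)` collapses to `α + β`.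
  have hle : R ∅ ≤ ω ^ α * ω ^ β := by
    refine hRe.trans ?_
    rw [hR'e, hRCe, hR₀e]
    refine (succ_opow_mul_opow_le (hβ.trans_le le_add_self)).trans ?_
    rw [← add_assoc, hβα, Ordinal.opow_add]
  obtain ⟨g₁, h₁⟩ := exists_gap_forall_erase_mem (hiC.addMin.tensor hi₀) hR
    ((rankGE_tensor hrk₁ (hpos _) hrkC).mono hle)
  obtain ⟨g₂, L₂, h₂⟩ := exists_gap_forall_mem hi₁ hR₁ hrk₀ (hR₁e ▸ hlt₀)
  obtain ⟨g₃, L₃, h₃⟩ := exists_gap_forall_mem hiC hRC hrk₁ (hRCe ▸ hlt₁)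
  -- Summing the gap functions and the thresholds makes one set `N` serve all three comparisons.
  obtain ⟨N, hNM, hN, hsp, hL⟩ :=
    exists_isSparse_subset (fun a => g₁ a + g₂ a + g₃ a) hM (L₂ + L₃)
  replace h₁ := h₁ N (hsp.mono fun a => by omega)
  replace h₂ := h₂ N (hsp.mono fun a => by omega) fun k hk => by have := hL k hk; omega
  replace h₃ := h₃ N (hsp.mono fun a => by omega) fun k hk => by have := hL k hk; omega
  have hθ : (0 : ℝ) < (θ : ℝ)⁻¹ := inv_pos.2 θ.2.1
  refine ⟨N, hNM, hN, 1 + (θ : ℝ)⁻¹, by linarith, fun a => ?_⟩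
  have hsupp : ↑(a.mapDomain (Subtype.val : N → ℕ)).support ⊆ N := fun k hk => by
    obtain ⟨i, -, rfl⟩ := Finset.mem_image.1 (Finsupp.mapDomain_support hk)
    exact i.2
  rw [norm_sum_basisVec_subtype B₀, norm_sum_basisVec_subtype B₁]
  have hle₁ := tNorm_le_of_forall_mem θ.2.1 θ.2.2 hB₁.hereditary hB₁.spreading h₂ hsupp
  refine ⟨(mul_le_of_le_one_left (tNorm_nonneg θ.2.1 θ.2.2 _) ?_).trans hle₁, ?_⟩
  · exact inv_le_one_of_one_le₀ (by linarith)
  · exact tNorm_le_mul_tNorm θ.2.1 θ.2.2 hB₀.hereditary hB₀.spreading hB₁.hereditary hrkC.mem h₁ h₃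
      hsupp
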